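/- For integers $n,d\ge 1$ let $P_{n,d}$ be the graph with vertex set $\{0,1,\dots,n\}$ in which $i$ and $j$ are adjacent if and only if $|i-j|\in\{1,3,\dots,2d+1\}$, and let $f_{n,d}$ be uniformly distributed on the finite set of functions $f:\{0,\dots,n\}\to\mathbb Z$ such that $f(0)=0$ and $|f(i)-f(j)|=1$ whenever $i$ and $j$ are adjacent. Write $\mathrm{Rng}(f)$ for the set of values of $f$. For $\kappa,\alpha>0$ let $\mu(\kappa,\alpha)$ be the parity-biased Poisson distribution $$\mu(\kappa,\alpha)=\frac{\alpha}{\alpha+\tanh\kappa}\,\mu^{\mathrm{even}}(\kappa)+\frac{\tanh\kappa}{\alpha+\tanh\kappa}\,\mu^{\mathrm{odd}}(\kappa),$$ where $\mu^{\mathrm{even}}(\kappa)$ and $\mu^{\mathrm{odd}}(\kappa)$ denote the law of a Poisson($\kappa$) variable conditioned to be even and odd, respectively. For $\lambda>0$ let $(S_i)_{i\ge 0}$ be a simple random walk on $\mathbb Z$ started at $0$, and let $N^{\pm}(\lambda)$ be independent of $(S_i)$ with law $\mu\big(\lambda/(2\sqrt2),(3/(2\sqrt2))^{\pm1}\big)$.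 For $k\ge 0$ write $\mathrm{Rng}(S_k)=\{S_i : 0\le i\le k\}$. **Theorem 2.5.** Let $\lambda\in(0,\infty)$, and let $(n_k)$ and $(d_k)$ be sequences of positive integers with $n_k\to\infty$ and $n_k2^{-d_k}\to\lambda$ as $k\to\infty$. If every $n_k$ is even, then $|\mathrm{Rng}(f_{n_k,d_k})|$ converges in distribution to $|\mathrm{Rng}(S_{N^+(\lambda)})|+2$ as $k\to\infty$; if every $n_k$ is odd, then it converges in distribution to $|\mathrm{Rng}(S_{N^-(\lambda)})|+2$. -/

import Mathlib

open MeasureTheory ProbabilityTheory Filter Topology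

noncomputable section

namespace ZHom

/-! ### Homomorphisms from a graph to the integers -/

/-- `Hom(G, v₀)`: the homomorphisms from `G` to `ℤ` (adjacent vertices are sent to adjacent
integers) which map `v₀` to `0`. -/
def homSet {V : Type*} (G : SimpleGraph V) (v₀ : V) : Set (V → ℤ) :=
  {f | f v₀ = 0 ∧ ∀ x y, G.Adj x y → |f x - f y| = 1}

/-- The graph `P_{n,d}` on `{0, 1, …, n}`: `i` and `j` are adjacent if and only if
`|i - j| ∈ {1, 3, …, 2d + 1}`. -/
def lineGraph (n d : ℕ) : SimpleGraph (Fin (n + 1)) where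
  Adj i j := ∃ m : ℕ, m ≤ d ∧ |((i : ℕ) : ℤ) - ((j : ℕ) : ℤ)| = 2 * (m : ℤ) + 1
  symm := ⟨fun _ _ ⟨m, hm, h⟩ => ⟨m, hm, by rw [abs_sub_comm]; exact h⟩⟩
  loopless := ⟨fun i ⟨m, _, h⟩ => by rw [sub_self, abs_zero] at h; omega⟩

/-- `Hom(P_{n,d}, 0)`. -/
def lineHom (n d : ℕ) : Set (Fin (n + 1) → ℤ) :=
  homSet (lineGraph n d) 0

theorem lineHom_abs_le {n d : ℕ} {f : Fin (n + 1) → ℤ} (hf : f ∈ lineHom n d) :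
    ∀ (k : ℕ) (hk : k < n + 1), |f ⟨k, hk⟩| ≤ (k : ℤ) := by
  intro k
  induction k with
  | zero =>
    intro hk
    have h0 : f ⟨0, hk⟩ = 0 := hf.1
    rw [h0]
    simp
  | succ k ih =>
    intro hk
    have h1 := ih (by omega)
    have h2 : |f ⟨k + 1, hk⟩ - f ⟨k, by omega⟩| = 1 :=
      hf.2 _ _ ⟨0, Nat.zero_le d, by simp⟩
    have h3 := abs_sub_abs_le_abs_sub (f ⟨k + 1, hk⟩) (f ⟨k, by omega⟩)
    push_cast
    linarith

theorem lineHom_finite (n d : ℕ) : (lineHom n d).Finite := by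
  refine (Set.Finite.pi' (t := fun i : Fin (n + 1) => Set.Icc (-(i : ℤ)) (i : ℤ))
    (fun _ => Set.finite_Icc _ _)).subset ?_
  intro f hf i
  exact abs_le.mp (lineHom_abs_le hf i.1 i.2)

theorem lineHom_nonempty (n d : ℕ) : (lineHom n d).Nonempty := by
  refine ⟨fun i => ((i : ℕ) : ℤ) % 2, by simp, ?_⟩
  rintro x y ⟨m, _, h⟩
  change |((x : ℕ) : ℤ) % 2 - ((y : ℕ) : ℤ) % 2| = 1
  rcases abs_cases (((x : ℕ) : ℤ) - ((y : ℕ) : ℤ)) with h1 | h1 <;>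
    rcases abs_cases (((x : ℕ) : ℤ) % 2 - ((y : ℕ) : ℤ) % 2) with h2 | h2 <;> omega

/-- The uniform distribution on `Hom(P_{n,d}, 0)`, i.e. the law of the random homomorphism
`f_{n,d}`. -/
def lineHomMeasure (n d : ℕ) : Measure (Fin (n + 1) → ℤ) :=
  uniformOn (lineHom n d)

instance instIsProbabilityMeasureLineHomMeasure (n d : ℕ) :
    IsProbabilityMeasure (lineHomMeasure n d) :=
  isProbabilityMeasure_uniformOn (lineHom_finite n d) (lineHom_nonempty n d)

/-- `|Rng(f)|`, the number of values taken by `f`. -/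
def rangeSize {V : Type*} (f : V → ℤ) : ℕ :=
  (Set.range f).ncard

/-! ### Simple random walk on the integers -/

/-- The uniform distribution on `{-1, 1}`, the law of one step of the walk. -/
def stepMeasure : Measure ℤ :=
  (PMF.uniformOfFinset ({-1, 1} : Finset ℤ) ⟨1, by simp⟩).toMeasure

instance instIsProbabilityMeasureStepMeasure : IsProbabilityMeasure stepMeasure :=
  PMF.toMeasure.isProbabilityMeasure _

/-- The law of an infinite sequence of independent uniform signs. -/
def stepsMeasure : Measure (ℕ → ℤ) :=
  Measure.infinitePi fun _ : ℕ => stepMeasure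

instance instIsProbabilityMeasureStepsMeasure : IsProbabilityMeasure stepsMeasure := by
  unfold stepsMeasure
  infer_instance

/-- The walk `S_i = ξ_0 + ⋯ + ξ_{i-1}` with steps `ξ`; it is a simple random walk when `ξ` is
distributed according to `stepsMeasure`. -/
def walk (ξ : ℕ → ℤ) (i : ℕ) : ℤ :=
  ∑ j ∈ Finset.range i, ξ j

/-- `|Rng(S_k)|`, where `Rng(S_k) = {S_i | 0 ≤ i ≤ k}` is the set of values of the walk up to
time `k`. -/
def walkRangeSize (ξ : ℕ → ℤ) (k : ℕ) : ℕ :=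
  {s : ℤ | ∃ i : ℕ, i ≤ k ∧ s = walk ξ i}.ncard

/-! ### Parity-biased Poisson distributions -/

/-- The parity-biased Poisson distribution with parameters `lam` and `alpha` (both meant to be
positive): the convex combination, with weights `alpha / (alpha + tanh lam)` and
`tanh lam / (alpha + tanh lam)`, of the law of a Poisson(`lam`) variable conditioned to be even
and the law of a Poisson(`lam`) variable conditioned to be odd. -/
def parityBiasedPoisson (lam alpha : ℝ) : Measure ℕ :=
  ENNReal.ofReal (alpha / (alpha + Real.tanh lam)) •
      cond (poissonMeasure lam.toNNReal) {k : ℕ | Even k} +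
    ENNReal.ofReal (Real.tanh lam / (alpha + Real.tanh lam)) •
      cond (poissonMeasure lam.toNNReal) {k : ℕ | Odd k}

theorem isProbabilityMeasure_parityBiasedPoisson {lam alpha : ℝ} (hlam : 0 < lam)
    (halpha : 0 < alpha) : IsProbabilityMeasure (parityBiasedPoisson lam alpha) := by
  have hpos : ∀ (s : Set ℕ) (k : ℕ), k ∈ s → poissonMeasure lam.toNNReal s ≠ 0 := by
    intro s k hk h0
    have h1 : poissonMeasure lam.toNNReal {k} = 0 :=
      measure_mono_null (Set.singleton_subset_iff.mpr hk) h0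
    have h2 := poissonMeasure_real_singleton_pos (r := lam.toNNReal) k (Real.toNNReal_pos.mpr hlam)
    rw [measureReal_def, h1] at h2
    simp at h2
  have := cond_isProbabilityMeasure (hpos {k : ℕ | Even k} 0 (by simp))
  have := cond_isProbabilityMeasure (hpos {k : ℕ | Odd k} 1 (by simp))
  have ht : 0 < Real.tanh lam := by
    rw [Real.tanh_eq_sinh_div_cosh]
    exact div_pos (Real.sinh_pos_iff.mpr hlam) (Real.cosh_pos lam)
  constructor
  simp only [parityBiasedPoisson, Measure.add_apply, Measure.smul_apply, measure_univ,
    smul_eq_mul, mul_one]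
  rw [← ENNReal.ofReal_add (by positivity) (by positivity), ← add_div,
    div_self (by positivity), ENNReal.ofReal_one]

/-- The parity-biased Poisson distribution with positive parameters, bundled as a probability
measure. -/
def parityBiasedPoissonLaw (lam alpha : ℝ) (hlam : 0 < lam) (halpha : 0 < alpha) :
    ProbabilityMeasure ℕ :=
  ⟨parityBiasedPoisson lam alpha, isProbabilityMeasure_parityBiasedPoisson hlam halpha⟩

/-- The joint law of (the steps of) a simple random walk and an independent random time with
law `N`. -/
def walkTimeMeasure (N : ProbabilityMeasure ℕ) : Measure ((ℕ → ℤ) × ℕ) :=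
  stepsMeasure.prod (N : Measure ℕ)

instance instIsProbabilityMeasureWalkTimeMeasure (N : ProbabilityMeasure ℕ) :
    IsProbabilityMeasure (walkTimeMeasure N) := by
  unfold walkTimeMeasure
  infer_instance

end ZHom

end

/-! Call p ≥ 2 a toggle of f if f(p) ≠ f(p-2). Between toggles f alternates between a centre and one
neighbour of it, and a toggle at p reflects that neighbour through the centre f(p-1). Consecutive
toggles of equal parity keep the centre. Consecutive toggles of opposite parity form a switch: the
centre moves one step, to the current neighbour. The edges of length 3, …, 2d+1 say exactly that a
switch has to wait 2d+1 units after the preceding toggle. So homomorphisms correspond to an initial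
sign together with an admissible list of toggle times (`decode_hom`, `exists_decode`,
`decode_injective`). As soon as there is one toggle, the range of f is the range of the walk of
centres widened by one at each end (`rangeSize_decode`), hence depends only on the list of switch
directions, the history.

It remains to count codes by history. Without switches there are θ(n) √2^n - 2 of them for each last
sign, where θ is 3/2 at even n and √2 at odd n (`cnt_nil`). Each switch takes 2d units of dead time
(`cnt_add`), which costs a factor √2^(-2d) = 2^(-d), but has of order n possible positions. For a
history of length j and a given last sign this yields √2^n θ(n+j) (n 2^(-d))^j / ((4√2)^j j!) to
leading order (`isLittleO_ncnt`, `tendsto_cnt`).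

The limiting weight depends on the history only through j. Given j, the directions are therefore
independent fair signs, so the centres perform a simple random walk. With x = λ/(2√2) and the 2^j
histories of length j, the weight of j is proportional to θ(n+j) x^j / j!. This is the parity-biased
Poisson law with bias θ(n)/θ(n+1), which is 3/(2√2) for even n and its inverse for odd n. The
uniform bound `cnt_le` justifies summing the limits over all histories, and the two functions
without toggles are negligible. -/

namespace ZHom

/-! ### Encoding homomorphisms by their toggle times -/

/-- The integer `±1` represented by a Boolean. -/
def sgn (b : Bool) : ℤ := if b then 1 else -1

theorem sgn_not (b : Bool) : sgn (!b) = -sgn b := by cases b <;> simp [sgn]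

theorem sgn_cases (b : Bool) : sgn b = 1 ∨ sgn b = -1 := by cases b <;> simp [sgn]

theorem sgn_injective : Function.Injective sgn := by
  intro a b; cases a <;> cases b <;> simp [sgn]

/-- The last toggle time of a code, with the convention that an empty code has one at `1`. -/
def lastTime : List ℕ → ℕ
  | [] => 1
  | p :: _ => p

/-- A list of toggle times, in decreasing order, is a code if any two consecutive ones of
opposite parity are at distance at least `2 * d + 1`. -/
def IsCode (d : ℕ) : List ℕ → Prop
  | [] => True
  -- The first toggle is unconstrained: the fictitious toggle at 1 has no value at time -1 to
  -- conflict with.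
  | p :: t => lastTime t < p ∧ (t = [] ∨ Even (p + lastTime t) ∨ lastTime t + 2 * d + 1 ≤ p) ∧
      IsCode d t

/-- The sign of the last increment at the last toggle time. -/
def lastSign (e : Bool) : List ℕ → Bool
  | [] => e
  | p :: t => if Even (p + lastTime t) then !lastSign e t else lastSign e t

/-- The successive displacements of the centre, the most recent one first. -/
def hist (e : Bool) : List ℕ → List Bool
  | [] => []
  -- The walk of centres starts at the centre of the first genuine toggle.
  | [_] => []
  | p :: q :: t =>
    if Even (p + q) then hist e (q :: t) else lastSign e (q :: t) :: hist e (q :: t)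

/-- The function with prescribed initial sign and toggle times. -/
def decode (e : Bool) : List ℕ → ℕ → ℤ
  | [], i => if Even i then 0 else sgn e
  | p :: t, i => if p ≤ i ∧ Even (i + p) then 2 * decode e t (p - 1) - decode e t i
      else decode e t i

theorem one_le_lastTime {d : ℕ} : ∀ {l : List ℕ}, IsCode d l → 1 ≤ lastTime l
  | [], _ => le_rfl
  | _ :: _, h => by have := h.1; simp only [lastTime]; omega

theorem decode_of_lt {e : Bool} {p i : ℕ} {t : List ℕ} (h : i < p) :
    decode e (p :: t) i = decode e t i := by
  rw [decode, if_neg (by omega)]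

/-- After its last toggle time a decoded function alternates between a centre and one of its
neighbours. -/
theorem decode_tail (d : ℕ) (e : Bool) : ∀ (l : List ℕ), IsCode d l → ∀ i, lastTime l ≤ i + 1 →
    decode e l i = decode e l (lastTime l - 1) +
      if Even (i + lastTime l) then sgn (lastSign e l) else 0
  | [], _, i, _ => by
    simp only [decode, lastTime, lastSign, Nat.even_add_one]
    by_cases h : Even i <;> simp [h]
  | p :: t, hl, i, hi => by
    have h1 := hl.1
    have h0 := one_le_lastTime hl.2.2
    have ih := decode_tail d e t hl.2.2
    change p ≤ i + 1 at hi
    change decode e (p :: t) i = decode e (p :: t) (p - 1) +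
      if Even (i + p) then sgn (if Even (p + lastTime t) then !lastSign e t else lastSign e t)
      else 0
    rw [decode_of_lt (show p - 1 < p by omega), decode]
    have e1 := ih i (by omega)
    have e2 := ih (p - 1) (by omega)
    have hp : Even (p - 1 + lastTime t) ↔ ¬ Even (p + lastTime t) := by
      simp only [Nat.even_iff]; omega
    by_cases hpi : Even (i + p)
    · have hpi' : p ≤ i := by
        by_contra hc
        have : i + 1 = p := by omega
        rw [Nat.even_iff] at hpi; omega
      have hit : Even (i + lastTime t) ↔ Even (p + lastTime t) := by
        simp only [Nat.even_iff] at hpi ⊢; omega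
      rw [if_pos ⟨hpi', hpi⟩, if_pos hpi, e1, e2]
      by_cases hq : Even (p + lastTime t)
      · simp only [hp, hit, hq, sgn_not, if_true, not_true_eq_false, if_false]; ring
      · simp only [hp, hit, hq, if_true, not_false_eq_true, if_false]; ring
    · have hit : Even (i + lastTime t) ↔ ¬ Even (p + lastTime t) := by
        simp only [Nat.even_iff] at hpi ⊢; omega
      rw [if_neg (by tauto), if_neg hpi, e1, e2]
      simp only [hp, hit, add_zero]

theorem decode_cons_tail {d : ℕ} {e : Bool} {p : ℕ} {t : List ℕ} (hl : IsCode d (p :: t)) {i : ℕ}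
    (hi : p ≤ i + 1) : decode e (p :: t) i = decode e (p :: t) (p - 1) +
      if Even (i + p) then sgn (lastSign e (p :: t)) else 0 :=
  decode_tail d e (p :: t) hl i hi

theorem decode_cons_self {d : ℕ} {e : Bool} {p : ℕ} {t : List ℕ} (hl : IsCode d (p :: t)) :
    decode e (p :: t) p = decode e (p :: t) (p - 1) + sgn (lastSign e (p :: t)) := by
  rw [decode_cons_tail hl (by omega), if_pos (by simp)]

/-- Without the toggle at p the values at p-2 and p agree; the toggle reflects only the latter
through the centre. The neighbours p-2, p of p-1 thus carry both values next to the centre. -/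
theorem decode_sub_two {d : ℕ} {e : Bool} {p : ℕ} {t : List ℕ} (hl : IsCode d (p :: t)) :
    decode e (p :: t) (p - 2) = decode e (p :: t) (p - 1) - sgn (lastSign e (p :: t)) := by
  have h1 := hl.1
  have h0 := one_le_lastTime hl.2.2
  have e1 := decode_cons_self (e := e) hl
  have e2 := decode_tail d e t hl.2.2 (p - 2) (by omega)
  have e3 := decode_tail d e t hl.2.2 p (by omega)
  have e4 : decode e (p :: t) p = 2 * decode e t (p - 1) - decode e t p := by
    rw [decode, if_pos ⟨le_rfl, by simp⟩]
  have e5 : Even (p - 2 + lastTime t) ↔ Even (p + lastTime t) := by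
    simp only [Nat.even_iff]; omega
  simp only [e5] at e2
  rw [← e3] at e2
  rw [decode_of_lt (show p - 1 < p by omega)] at e1 ⊢
  rw [decode_of_lt (show p - 2 < p by omega)]
  linarith

/-- Before the last toggle time the class of the opposite parity is constant on a long window. -/
theorem decode_window (d : ℕ) (e : Bool) : ∀ (l : List ℕ), IsCode d l → ∀ i,
    lastTime l ≤ i + 2 * d + 1 → i < lastTime l → ¬ Even (i + lastTime l) →
    decode e l i = decode e l (lastTime l - 1)
  | [], _, i, _, h2, _ => by
    simp only [lastTime] at h2 ⊢
    rw [show i = 0 by omega]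
  | p :: t, hl, i, h1, h2, h3 => by
    have hlt := hl.1
    have h0 := one_le_lastTime hl.2.2
    simp only [lastTime] at h1 h2 h3 ⊢
    rw [decode_of_lt h2, decode_of_lt (show p - 1 < p by omega)]
    have key : lastTime t ≤ i + 1 → decode e t i = decode e t (p - 1) := by
      intro h
      rw [decode_tail d e t hl.2.2 i h, decode_tail d e t hl.2.2 (p - 1) (by omega)]
      have : Even (i + lastTime t) ↔ Even (p - 1 + lastTime t) := by
        simp only [Nat.even_iff] at h3 ⊢; omega
      simp only [this]
    rcases Nat.lt_or_ge (i + 1) (lastTime t) with h | h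
    -- If the previous toggle has the parity of p, the centre is the same and its own window covers
    -- i. If it has the opposite parity, the gap of 2d+1 puts the whole window after it, so i cannot
    -- precede it.
    · rcases hl.2.1 with h4 | h4 | h4
      · subst h4; simp only [lastTime] at h; omega
      · rw [decode_window d e t hl.2.2 i (by omega) (by omega)
          (by simp only [Nat.even_iff] at h3 h4 ⊢; omega)]
        rw [decode_tail d e t hl.2.2 (p - 1) (by omega), if_neg, add_zero]
        simp only [Nat.even_iff] at h4 ⊢; omega
      · omega
    · exact key h

theorem abs_sgn (b : Bool) : |sgn b| = 1 := by cases b <;> simp [sgn]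

/-- Decoded functions are homomorphisms. -/
theorem decode_hom (d : ℕ) (e : Bool) : ∀ (l : List ℕ), IsCode d l → ∀ i m, m ≤ d →
    |decode e l (i + 2 * m + 1) - decode e l i| = 1
  | [], _, i, m, _ => by
    have : Even (i + 2 * m + 1) ↔ ¬ Even i := by simp only [Nat.even_iff]; omega
    simp only [decode, this]
    by_cases h : Even i <;> simp [h, abs_sgn]
  | p :: t, hl, i, m, hm => by
    have hlt := hl.1
    have h0 := one_le_lastTime hl.2.2
    have ih := decode_hom d e t hl.2.2 i m hm
    have ht := fun i => decode_cons_tail (e := e) hl (i := i)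
    rcases Nat.lt_or_ge (i + 2 * m + 1) p with h | h
    · rwa [decode_of_lt h, decode_of_lt (by omega)]
    rcases Nat.lt_or_ge (i + 1) p with h' | h'
    -- The two indices straddle p. If the later one has the parity of p, the earlier one lies in the
    -- window and carries the centre value; otherwise the toggle affects neither.
    · by_cases hj : Even (i + 2 * m + 1 + p)
      · have hw := decode_window d e _ hl i (by simp only [lastTime]; omega)
          (by simp only [lastTime]; omega)
          (by simp only [lastTime, Nat.even_iff] at hj ⊢; omega)
        simp only [lastTime] at hw
        rw [hw, ht _ (by omega), if_pos hj, add_sub_cancel_left, abs_sgn]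
      · rw [decode_of_lt (show i < p by omega), decode, if_neg (by tauto)]
        exact ih
    · rw [ht (i + 2 * m + 1) (by omega), ht i (by omega)]
      have : Even (i + 2 * m + 1 + p) ↔ ¬ Even (i + p) := by simp only [Nat.even_iff]; omega
      simp only [this]
      by_cases hip : Even (i + p) <;> simp [hip, abs_sgn]

theorem decode_zero (d : ℕ) (e : Bool) : ∀ (l : List ℕ), IsCode d l → decode e l 0 = 0
  | [], _ => by simp [decode]
  | p :: t, hl => by
    have hlt := hl.1
    rw [decode_of_lt (by omega), decode_zero d e t hl.2.2]

/-- Every homomorphism on `{0, …, n + 1}` has a code. -/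
theorem exists_decode (d : ℕ) (g : ℕ → ℤ) (h0 : g 0 = 0) : ∀ n,
    (∀ i m, m ≤ d → i + 2 * m + 1 ≤ n + 1 → |g (i + 2 * m + 1) - g i| = 1) →
    ∃ e l, IsCode d l ∧ lastTime l ≤ n + 1 ∧ ∀ i, i ≤ n + 1 → decode e l i = g i
  | 0, hg => by
    have h1 := hg 0 0 (by omega) (by omega)
    simp only [mul_zero, zero_add, h0, sub_zero] at h1
    have : ∃ e, g 1 = sgn e := by
      rcases eq_or_eq_neg_of_abs_eq h1 with h | h
      · exact ⟨true, by simp [sgn, h]⟩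
      · exact ⟨false, by simp [sgn, h]⟩
    obtain ⟨e, he⟩ := this
    refine ⟨e, [], trivial, le_rfl, fun i hi => ?_⟩
    interval_cases i
    · simp [decode, h0]
    · simp [decode, he]
  | n + 1, hg => by
    obtain ⟨e, l, hl, hlast, hdec⟩ := exists_decode d g h0 n
      (fun i m hm hi => hg i m hm (by omega))
    have h1 : |g (n + 2) - g (n + 1)| = 1 := hg (n + 1) 0 (by omega) (by omega)
    have h2 : |decode e l (n + 2) - decode e l (n + 1)| = 1 :=
      decode_hom d e l hl (n + 1) 0 (by omega)
    rw [hdec (n + 1) le_rfl] at h2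
    by_cases hk : decode e l (n + 2) = g (n + 2)
    · refine ⟨e, l, hl, by omega, fun i hi => ?_⟩
      rcases Nat.lt_or_ge i (n + 2) with h | h
      · exact hdec i (by omega)
      · rwa [show i = n + 2 by omega]
    -- Both candidates at n+2 are neighbours of g(n+1), so if they differ they are reflections of
    -- each other and a toggle at n+2 repairs the code.
    · have htog : g (n + 2) = 2 * g (n + 1) - decode e l (n + 2) := by
        rcases eq_or_eq_neg_of_abs_eq h1 with h | h <;>
          rcases eq_or_eq_neg_of_abs_eq h2 with h' | h' <;>
          first | linarith | (exfalso; apply hk; linarith)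
      refine ⟨e, (n + 2) :: l, ⟨by omega, ?_, hl⟩, by simp [lastTime], fun i hi => ?_⟩
      · cases l with
        | nil => left; rfl
        | cons p t =>
          right
          by_contra hc
          push Not at hc
          obtain ⟨hc1, hc2⟩ := hc
          simp only [lastTime] at hlast hc1 hc2
          have hp1 := hl.1
          have hp0 := one_le_lastTime hl.2.2
          -- Suppose the new toggle were a switch made too soon after p. Then n+2 is adjacent to
          -- both p and p-2, where g takes the values c+s and c-s around the centre c. This forces
          -- g(n+2) = c, which the old code already gives, so no toggle was needed.
          have hodd : ∃ k, n + 2 = p + 2 * k + 1 := by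
            rw [Nat.even_iff] at hc1
            exact ⟨(n + 1 - p) / 2, by omega⟩
          obtain ⟨k, hk'⟩ := hodd
          have a1 := hg p k (by omega) (by omega)
          have a2 := hg (p - 2) (k + 1) (by omega) (by omega)
          rw [show p - 2 + 2 * (k + 1) + 1 = n + 2 by omega] at a2
          rw [← hk'] at a1
          rw [← hdec p (by omega)] at a1
          rw [← hdec (p - 2) (by omega), decode_sub_two hl] at a2
          have t1 := decode_cons_self (e := e) hl
          have t2 := decode_cons_tail (e := e) hl (i := n + 2) (by omega)
          rw [if_neg hc1] at t2
          rw [t1] at a1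
          rw [t2] at hk
          apply hk
          rcases sgn_cases (lastSign e (p :: t)) with hs | hs <;> rw [hs] at a1 a2 <;>
          rcases eq_or_eq_neg_of_abs_eq a1 with h | h <;>
          rcases eq_or_eq_neg_of_abs_eq a2 with h' | h' <;> linarith
      · rcases Nat.lt_or_ge i (n + 2) with h | h
        · rw [decode_of_lt h, hdec i (by omega)]
        · rw [show i = n + 2 by omega, decode, if_pos ⟨le_rfl, by simp⟩, htog]
          rw [show n + 2 - 1 = n + 1 by omega, hdec _ le_rfl]

theorem decode_ne_sub_two {d : ℕ} {e : Bool} {p : ℕ} {t : List ℕ} (hl : IsCode d (p :: t)) :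
    decode e (p :: t) p ≠ decode e (p :: t) (p - 2) := by
  rw [decode_sub_two hl, decode_cons_self hl]
  rcases sgn_cases (lastSign e (p :: t)) with h | h <;> rw [h] <;> intro h' <;> linarith

theorem decode_eq_sub_two {d : ℕ} {e : Bool} {l : List ℕ} (hl : IsCode d l) {p : ℕ}
    (hp : lastTime l < p) : decode e l p = decode e l (p - 2) := by
  have h0 := one_le_lastTime hl
  rw [decode_tail d e l hl p (by omega), decode_tail d e l hl (p - 2) (by omega)]
  have : Even (p - 2 + lastTime l) ↔ Even (p + lastTime l) := by
    simp only [Nat.even_iff]; omega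
  simp only [this]

/-- A toggle is an involution, so the last one can be stripped off the function. -/
theorem decode_cons_eq {e : Bool} {p : ℕ} {t : List ℕ} (hp : 1 ≤ p) (i : ℕ) :
    decode e t i = if p ≤ i ∧ Even (i + p) then
      2 * decode e (p :: t) (p - 1) - decode e (p :: t) i else decode e (p :: t) i := by
  rw [decode_of_lt (show p - 1 < p by omega), decode]
  by_cases h : p ≤ i ∧ Even (i + p)
  · simp only [if_pos h]; ring
  · simp only [if_neg h]

/-- The code of a homomorphism is unique. -/
theorem decode_injective (d n : ℕ) (hn : 1 ≤ n) (e e' : Bool) : ∀ l l' : List ℕ,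
    IsCode d l → IsCode d l' → lastTime l ≤ n → lastTime l' ≤ n →
    (∀ i, i ≤ n → decode e l i = decode e' l' i) → e = e' ∧ l = l'
  | [], [], _, _, _, _, h => by
    have h1 := h 1 hn
    simp only [decode, Nat.not_even_one, if_false] at h1
    exact ⟨sgn_injective h1, rfl⟩
  | [], p :: t, hl, hl', _, hp, h => by
    exfalso
    have h1 := hl'.1
    have h0 := one_le_lastTime hl'.2.2
    simp only [lastTime] at hp
    apply decode_ne_sub_two (e := e') hl'
    rw [← h p hp, ← h (p - 2) (by omega)]
    exact decode_eq_sub_two hl (by simp only [lastTime]; omega)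
  | p :: t, [], hl', hl, hp, _, h => by
    exfalso
    have h1 := hl'.1
    have h0 := one_le_lastTime hl'.2.2
    simp only [lastTime] at hp
    apply decode_ne_sub_two (e := e) hl'
    rw [h p hp, h (p - 2) (by omega)]
    exact decode_eq_sub_two hl (by simp only [lastTime]; omega)
  | p :: t, q :: u, hl, hl', hp, hq, h => by
    simp only [lastTime] at hp hq
    have hp1 := hl.1
    have hq1 := hl'.1
    have hpq : p = q := by
      -- The last toggle is visible in the function as the last time its value differs from the
      -- value two steps earlier.
      rcases lt_trichotomy p q with hlt | heq | hlt
      · exfalso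
        apply decode_ne_sub_two (e := e') hl'
        rw [← h q hq, ← h (q - 2) (by omega)]
        exact decode_eq_sub_two hl (by simpa only [lastTime])
      · exact heq
      · exfalso
        apply decode_ne_sub_two (e := e) hl
        rw [h p hp, h (p - 2) (by omega)]
        exact decode_eq_sub_two hl' (by simpa only [lastTime])
    subst hpq
    obtain ⟨he, ht⟩ := decode_injective d n hn e e' t u hl.2.2 hl'.2.2 (by omega) (by omega) (by
      intro i hi
      rw [decode_cons_eq (show 1 ≤ p by omega) i, decode_cons_eq (e := e') (show 1 ≤ p by omega) i,
        h i hi, h (p - 1) (by omega)])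
    exact ⟨he, by rw [ht]⟩

/-! ### The range of a decoded function -/

/-- The least value of a walk with the given history, relative to its endpoint. -/
def lowest : List Bool → ℤ
  | [] => 0
  | s :: L => min 0 (lowest L - sgn s)

/-- The largest value of a walk with the given history, relative to its endpoint. -/
def highest : List Bool → ℤ
  | [] => 0
  | s :: L => max 0 (highest L - sgn s)

theorem lowest_nonpos : ∀ L, lowest L ≤ 0
  | [] => le_rfl
  | _ :: _ => min_le_left _ _

theorem highest_nonneg : ∀ L, 0 ≤ highest L
  | [] => le_rfl
  | _ :: _ => le_max_left _ _

/-- The number of values of a walk with the given history. -/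
def histRange (L : List Bool) : ℕ := (highest L - lowest L + 1).toNat

/-- At a first toggle p the range consists of the centre and its two neighbours, taken at p-2 and p.
Each later toggle adds at most the value at p: after a switch it lies one beyond the new centre, and
after a toggle of equal parity it was attained before. -/
theorem exists_decode_eq_iff (d : ℕ) (e : Bool) : ∀ (p : ℕ) (t : List ℕ), IsCode d (p :: t) →
    ∀ n, p ≤ n → ∀ z, (∃ i, i ≤ n ∧ decode e (p :: t) i = z) ↔
      decode e (p :: t) (p - 1) + lowest (hist e (p :: t)) - 1 ≤ z ∧
      z ≤ decode e (p :: t) (p - 1) + highest (hist e (p :: t)) + 1 := by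
  intro p t
  induction t generalizing p with
  | nil =>
    intro hl n hn z
    have hp := hl.1
    simp only [lastTime] at hp
    have hc := fun i => decode_cons_tail (e := e) hl (i := i)
    have hsub := decode_sub_two (e := e) hl
    simp only [hist, lowest, highest]
    constructor
    · rintro ⟨i, hi, rfl⟩
      rcases Nat.lt_or_ge (i + 1) p with h | h
      · rcases Nat.even_or_odd (i + p) with h' | h'
        · have : decode e [p] i = decode e [p] (p - 2) := by
            rw [decode_of_lt (by omega), decode_of_lt (by omega)]
            have : Even i ↔ Even (p - 2) := by simp only [Nat.even_iff] at h' ⊢; omega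
            simp only [decode, this]
          rw [this, hsub]
          rcases sgn_cases (lastSign e [p]) with hs | hs <;> rw [hs] <;> constructor <;> linarith
        · have : decode e [p] i = decode e [p] (p - 1) := by
            rw [decode_of_lt (by omega), decode_of_lt (by omega)]
            have : Even i ↔ Even (p - 1) := by
              rw [← Nat.not_even_iff_odd] at h'; simp only [Nat.even_iff] at h' ⊢; omega
            simp only [decode, this]
          rw [this]; constructor <;> linarith
      · rw [hc i h]
        split_ifs
        · rcases sgn_cases (lastSign e [p]) with hs | hs <;> rw [hs] <;> constructor <;> linarith
        · constructor <;> linarith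
    · rintro ⟨h1, h2⟩
      have hcp := decode_cons_self (e := e) hl
      rcases sgn_cases (lastSign e [p]) with hs | hs <;> rw [hs] at hcp hsub
      · rcases (by omega : z = decode e [p] (p - 1) ∨ z = decode e [p] (p - 1) + 1 ∨
          z = decode e [p] (p - 1) - 1) with h | h | h
        · exact ⟨p - 1, by omega, h.symm⟩
        · exact ⟨p, by omega, by rw [hcp, h]⟩
        · exact ⟨p - 2, by omega, by rw [hsub, h]⟩
      · rcases (by omega : z = decode e [p] (p - 1) ∨ z = decode e [p] (p - 1) + 1 ∨
          z = decode e [p] (p - 1) - 1) with h | h | h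
        · exact ⟨p - 1, by omega, h.symm⟩
        · exact ⟨p - 2, by omega, by rw [hsub, h]; ring⟩
        · exact ⟨p, by omega, by rw [hcp, h]; ring⟩
  | cons q t ih =>
    intro hl n hn z
    have hp := hl.1
    simp only [lastTime] at hp
    have hq0 := hl.2.2.1
    have ih := ih q hl.2.2 (p - 1) (by omega) z
    have hc := fun i => decode_cons_tail (e := e) hl (i := i)
    have hcp := decode_cons_self (e := e) hl
    -- From time p on, only the centre, already attained at p-1, and the value at p occur.
    have step : (∃ i, i ≤ n ∧ decode e (p :: q :: t) i = z) ↔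
        (∃ i, i ≤ p - 1 ∧ decode e (q :: t) i = z) ∨
          z = decode e (p :: q :: t) (p - 1) + sgn (lastSign e (p :: q :: t)) := by
      constructor
      · rintro ⟨i, hi, rfl⟩
        rcases Nat.lt_or_ge i p with h | h
        · exact Or.inl ⟨i, by omega, (decode_of_lt h).symm⟩
        · rw [hc i (by omega)]
          split_ifs with h'
          · exact Or.inr rfl
          · exact Or.inl ⟨p - 1, le_rfl, by
            rw [add_zero]; exact (decode_of_lt (by omega)).symm⟩
      · rintro (⟨i, hi, rfl⟩ | h)
        · exact ⟨i, by omega, decode_of_lt (by omega)⟩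
        · exact ⟨p, hn, by rw [hcp, h]⟩
    rw [step, ih]
    have hpc : decode e (p :: q :: t) (p - 1) = decode e (q :: t) (q - 1) +
        if Even (p + q) then 0 else sgn (lastSign e (q :: t)) := by
      rw [decode_of_lt (by omega), decode_tail d e _ hl.2.2 _ (by simp only [lastTime]; omega)]
      simp only [lastTime]
      have : Even (p - 1 + q) ↔ ¬ Even (p + q) := by simp only [Nat.even_iff]; omega
      simp only [this, ite_not]
    have hlo := lowest_nonpos (hist e (q :: t))
    have hhi := highest_nonneg (hist e (q :: t))
    rw [hpc]
    rw [show lastSign e (p :: q :: t) =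
      if Even (p + q) then !lastSign e (q :: t) else lastSign e (q :: t) from rfl]
    simp only [hist]
    generalize decode e (q :: t) (q - 1) = c at *
    have hs := sgn_cases (lastSign e (q :: t))
    by_cases he : Even (p + q)
    · simp only [he, if_true, sgn_not]
      omega
    · simp only [he, if_false, lowest, highest]
      omega

theorem rangeSize_decode {d : ℕ} {e : Bool} {p : ℕ} {t : List ℕ} (hl : IsCode d (p :: t))
    {n : ℕ} (hn : p ≤ n) :
    rangeSize (fun i : Fin (n + 1) => decode e (p :: t) i) = histRange (hist e (p :: t)) + 2 := by
  have : Set.range (fun i : Fin (n + 1) => decode e (p :: t) i) =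
      ((Finset.Icc (decode e (p :: t) (p - 1) + lowest (hist e (p :: t)) - 1)
        (decode e (p :: t) (p - 1) + highest (hist e (p :: t)) + 1) : Finset ℤ) : Set ℤ) := by
    ext z
    rw [Finset.coe_Icc, Set.mem_Icc, ← exists_decode_eq_iff d e p t hl n hn z]
    constructor
    · rintro ⟨i, rfl⟩
      exact ⟨i, by omega, rfl⟩
    · rintro ⟨i, hi, h⟩
      exact ⟨⟨i, by omega⟩, h⟩
  rw [rangeSize, this, Set.ncard_coe_finset, Int.card_Icc, histRange]
  have hlo := lowest_nonpos (hist e (p :: t))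
  have hhi := highest_nonneg (hist e (p :: t))
  omega

/-! ### Counting codes -/

/-- The nonempty codes of functions on `{0, …, n}` with last sign `s` and history `L`. -/
def codes (d n : ℕ) (s : Bool) (L : List Bool) : Set (Bool × ℕ × List ℕ) :=
  {x | IsCode d (x.2.1 :: x.2.2) ∧ x.2.1 ≤ n ∧ lastSign x.1 (x.2.1 :: x.2.2) = s ∧
    hist x.1 (x.2.1 :: x.2.2) = L}

/-- The cardinality of `codes d n s L`. -/
def cnt (d : ℕ) : ℕ → Bool → List Bool → ℕ
  | 0, _, _ => 0
  | 1, _, _ => 0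
  | n + 2, _, [] => cnt d n true [] + cnt d n false [] + min (n + 1) 2
  | n + 2, s, b :: L => cnt d n true (b :: L) + cnt d n false (b :: L) +
      if b = s ∧ 2 * d ≤ n + 1 then cnt d (n + 1 - 2 * d) s L else 0
  termination_by n => n
  decreasing_by all_goals omega

/-- Delay the last toggle by two units of time. -/
def delay (x : Bool × ℕ × List ℕ) : Bool × ℕ × List ℕ := (x.1, x.2.1 + 2, x.2.2)

/-- Add a toggle `g` units of time after the last one. -/
def extend (g : ℕ) (x : Bool × ℕ × List ℕ) : Bool × ℕ × List ℕ :=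
  (x.1, x.2.1 + g, x.2.1 :: x.2.2)

theorem delay_injective : Function.Injective delay := by
  rintro ⟨e, p, t⟩ ⟨e', p', t'⟩ h
  simp only [delay, Prod.mk.injEq] at h ⊢
  exact ⟨h.1, by omega, h.2.2⟩

theorem extend_injective (g : ℕ) : Function.Injective (extend g) := by
  rintro ⟨e, p, t⟩ ⟨e', p', t'⟩ h
  simp only [extend, Prod.mk.injEq, List.cons.injEq] at h ⊢
  exact ⟨h.1, h.2.2⟩

theorem even_add_two_add (a b : ℕ) : Even (a + 2 + b) ↔ Even (a + b) := by
  simp only [Nat.even_iff]; omega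

theorem isCode_delay {d p : ℕ} {t : List ℕ} (h : IsCode d (p :: t)) : IsCode d ((p + 2) :: t) := by
  obtain ⟨h1, h2, h3⟩ := h
  refine ⟨by omega, ?_, h3⟩
  rw [even_add_two_add]
  rcases h2 with h2 | h2 | h2
  · exact Or.inl h2
  · exact Or.inr (Or.inl h2)
  · exact Or.inr (Or.inr (by omega))

theorem lastSign_delay (e : Bool) (p : ℕ) (t : List ℕ) :
    lastSign e ((p + 2) :: t) = lastSign e (p :: t) := by
  simp only [lastSign, even_add_two_add]

theorem hist_delay (e : Bool) (p : ℕ) (t : List ℕ) :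
    hist e ((p + 2) :: t) = hist e (p :: t) := by
  cases t with
  | nil => rfl
  | cons q t => simp only [hist, even_add_two_add]

/-- The codes with a single toggle, at one of the first two possible times. -/
def initialCodes (n : ℕ) (s : Bool) (L : List Bool) : Set (Bool × ℕ × List ℕ) :=
  {x | x.2.2 = [] ∧ L = [] ∧ (x.2.1 = 2 ∨ x.2.1 = 3) ∧ x.2.1 ≤ n ∧ lastSign x.1 [x.2.1] = s}

/-- The codes whose last toggle is a switch, as early as possible. -/
def switchCodes (d n : ℕ) (s : Bool) : List Bool → Set (Bool × ℕ × List ℕ)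
  | [] => ∅
  | b :: L => if b = s ∧ 2 * d + 1 ≤ n then
      extend (2 * d + 1) '' codes d (n - (2 * d + 1)) s L else ∅

theorem extend_mem_codes {d n : ℕ} {s : Bool} {L : List Bool} {x : Bool × ℕ × List ℕ}
    (hx : x ∈ codes d n s L) : extend (2 * d + 1) x ∈ codes d (n + (2 * d + 1)) s (s :: L) := by
  obtain ⟨e, p, t⟩ := x
  obtain ⟨h1, h2, h3, h4⟩ := hx
  simp only at h1 h2 h3 h4
  have ho : ¬ Even (p + (2 * d + 1) + p) := by simp only [Nat.even_iff]; omega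
  refine ⟨⟨?_, ?_, h1⟩, ?_, ?_, ?_⟩
  · simp only [lastTime, extend]; omega
  · right; right; simp only [lastTime, extend]; omega
  · simp only [extend]; omega
  · simp only [extend]
    rw [lastSign, lastTime, if_neg ho, h3]
  · simp only [extend]
    rw [hist, if_neg ho, h3, h4]

/-- Consider the gap before the last toggle. If it is minimal for its parity, 2 or 2d+1, that toggle
can be deleted; otherwise it can be moved back by two. A gap of 2 flips the sign, hence `!s`,
whereas a switch preserves it and records it in the history. A lone toggle at 2 or 3 cannot be moved
back and is the initial case. -/
theorem codes_add_two (d n : ℕ) (s : Bool) (L : List Bool) :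
    codes d (n + 2) s L = delay '' codes d n s L ∪ extend 2 '' codes d n (!s) L ∪
      initialCodes (n + 2) s L ∪ switchCodes d (n + 2) s L := by
  ext ⟨e, p, t⟩
  constructor
  · rintro ⟨h1, h2, h3, h4⟩
    simp only at h1 h2 h3 h4
    obtain ⟨h5, h6, h7⟩ := h1
    cases t with
    | nil =>
      left
      simp only [lastTime] at h5
      rcases Nat.lt_or_ge p 4 with hp | hp
      · right
        exact ⟨rfl, by simpa [hist] using h4.symm, by simp only; omega, h2, h3⟩
      · left; left
        obtain ⟨p, rfl⟩ : ∃ q, p = q + 2 := ⟨p - 2, by omega⟩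
        refine ⟨(e, p, []), ⟨⟨?_, Or.inl rfl, trivial⟩, ?_, ?_, ?_⟩, rfl⟩
        · simp only [lastTime]; omega
        · simp only; omega
        · rw [← h3]; exact (lastSign_delay e p []).symm
        · rw [← h4]; exact (hist_delay e p []).symm
    | cons q t =>
      simp only [lastTime] at h5 h6
      have hq := h7.1
      have hq' := one_le_lastTime h7.2.2
      by_cases hc : p = q + 2
      · left; left; right
        subst hc
        have he : Even (q + 2 + q) := by simp only [Nat.even_iff]; omega
        rw [lastSign, lastTime, if_pos he] at h3
        rw [hist, if_pos he] at h4
        refine ⟨(e, q, t), ⟨h7, by simp only; omega, ?_, h4⟩, rfl⟩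
        rw [← h3, Bool.not_not]
      by_cases hc' : p = q + (2 * d + 1)
      · right
        subst hc'
        have ho : ¬ Even (q + (2 * d + 1) + q) := by simp only [Nat.even_iff]; omega
        rw [lastSign, lastTime, if_neg ho] at h3
        rw [hist, if_neg ho] at h4
        subst h4
        rw [switchCodes, if_pos ⟨h3, by omega⟩]
        exact ⟨(e, q, t), ⟨h7, by simp only; omega, h3, rfl⟩, rfl⟩
      -- The gap exceeds the minimum for its parity, hence by at least 2.
      · left; left; left
        have h8 : Even (p + q) ∨ q + 2 * d + 1 ≤ p := by
          rcases h6 with h6 | h6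
          · cases h6
          · exact h6
        rw [Nat.even_iff] at h8
        obtain ⟨p, rfl⟩ : ∃ q, p = q + 2 := ⟨p - 2, by omega⟩
        refine ⟨(e, p, q :: t), ⟨⟨?_, Or.inr ?_, h7⟩, ?_, ?_, ?_⟩, rfl⟩
        · simp only [lastTime]; omega
        · simp only [lastTime, Nat.even_iff]; omega
        · simp only; omega
        · rw [← h3]; exact (lastSign_delay e p _).symm
        · rw [← h4]; exact (hist_delay e p _).symm
  · rintro (((⟨⟨e', p', t'⟩, ⟨h1, h2, h3, h4⟩, h⟩ | ⟨⟨e', p', t'⟩, ⟨h1, h2, h3, h4⟩, h⟩) |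
      ⟨h1, h2, h3, h4, h5⟩) | h)
    · simp only [delay, Prod.mk.injEq] at h
      obtain ⟨rfl, rfl, rfl⟩ := h
      refine ⟨isCode_delay h1, by simp only at h2 ⊢; omega, ?_, ?_⟩
      · rw [← h3]; exact lastSign_delay _ _ _
      · rw [← h4]; exact hist_delay _ _ _
    · simp only [extend, Prod.mk.injEq] at h
      obtain ⟨rfl, rfl, rfl⟩ := h
      have he : Even (p' + 2 + p') := by simp only [Nat.even_iff]; omega
      refine ⟨⟨by simp only [lastTime]; omega, Or.inr (Or.inl he), h1⟩,
        by simp only at h2 ⊢; omega, ?_, ?_⟩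
      · simp only at h3 ⊢
        rw [lastSign, lastTime, if_pos he, h3, Bool.not_not]
      · simp only at h4 ⊢
        rw [hist, if_pos he, h4]
    · simp only at h1 h3 h4 h5
      subst h1 h2
      exact ⟨⟨by simp only [lastTime]; omega, Or.inl rfl, trivial⟩, h4, h5, rfl⟩
    · cases L with
      | nil => exact h.elim
      | cons b L =>
        rw [switchCodes] at h
        split_ifs at h with hb
        · obtain ⟨x, hx, hxe⟩ := h
          rw [← hxe, hb.1]
          have := extend_mem_codes hx
          rwa [Nat.sub_add_cancel hb.2] at this
        · exact h.elim

theorem exists_lastSign_eq (p : ℕ) (s : Bool) : ∃! e, lastSign e [p] = s := by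
  by_cases h : Even (p + 1)
  · refine ⟨!s, by simp [lastSign, lastTime, h], fun y hy => ?_⟩
    simp only [lastSign, lastTime, h, if_true] at hy
    rw [← hy, Bool.not_not]
  · refine ⟨s, by simp [lastSign, lastTime, h], fun y hy => ?_⟩
    simpa only [lastSign, lastTime, h, if_false] using hy

theorem encard_initialCodes_nil (n : ℕ) (s : Bool) :
    (initialCodes (n + 2) s []).encard = (min (n + 1) 2 : ℕ) := by
  obtain ⟨e, he, he'⟩ := exists_lastSign_eq 2 s
  obtain ⟨f, hf, hf'⟩ := exists_lastSign_eq 3 s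
  simp only at he he' hf hf'
  rcases Nat.eq_zero_or_pos n with rfl | hn
  · have : initialCodes (0 + 2) s [] = {(e, 2, [])} := by
      ext ⟨x, p, t⟩
      simp only [initialCodes, Set.mem_ofPred_eq, Set.mem_singleton_iff, Prod.mk.injEq]
      constructor
      · rintro ⟨rfl, -, h1, h2, h3⟩
        obtain rfl : p = 2 := by omega
        exact ⟨he' _ h3, rfl, rfl⟩
      · rintro ⟨rfl, rfl, rfl⟩
        exact ⟨rfl, trivial, Or.inl rfl, le_rfl, he⟩
    rw [this]
    simp
  · have : initialCodes (n + 2) s [] = {(e, 2, []), (f, 3, [])} := by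
      ext ⟨x, p, t⟩
      simp only [initialCodes, Set.mem_ofPred_eq, Set.mem_singleton_iff, Set.mem_insert_iff,
        Prod.mk.injEq]
      constructor
      · rintro ⟨rfl, -, rfl | rfl, h2, h3⟩
        · exact Or.inl ⟨he' _ h3, rfl, rfl⟩
        · exact Or.inr ⟨hf' _ h3, rfl, rfl⟩
      · rintro (⟨rfl, rfl, rfl⟩ | ⟨rfl, rfl, rfl⟩)
        · exact ⟨rfl, trivial, Or.inl rfl, by omega, he⟩
        · exact ⟨rfl, trivial, Or.inr rfl, by omega, hf⟩
    rw [this, Set.encard_pair (by simp), min_eq_right (by omega)]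
    rfl

theorem initialCodes_cons (n : ℕ) (s b : Bool) (L : List Bool) :
    initialCodes n s (b :: L) = ∅ := by
  ext x; simp [initialCodes]

theorem codes_eq_empty {d n : ℕ} (hn : n < 2) (s : Bool) (L : List Bool) :
    codes d n s L = ∅ := by
  ext x
  simp only [codes, Set.mem_ofPred_eq, Set.mem_empty_iff_false, iff_false]
  rintro ⟨h1, h2, -⟩
  have := h1.1
  have := one_le_lastTime h1.2.2
  omega

theorem disjoint_delay_extend {d n m : ℕ} {s s' : Bool} {L L' : List Bool} {g : ℕ}
    (hg : g = 2 ∨ g = 2 * d + 1) :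
    Disjoint (delay '' codes d n s L) (extend g '' codes d m s' L') := by
  rw [Set.disjoint_left]
  rintro _ ⟨⟨e, p, t⟩, hx, rfl⟩ ⟨⟨e', p', t'⟩, hy, h⟩
  simp only [delay, extend, Prod.mk.injEq] at h
  obtain ⟨rfl, h1, rfl⟩ := h
  have h2 := hx.1.1
  have h3 := hx.1.2.1
  simp only [lastTime, reduceCtorEq, false_or, Nat.even_iff] at h2 h3
  omega

theorem disjoint_extend_extend {d n m : ℕ} {s s' : Bool} {L L' : List Bool} :
    Disjoint (extend 2 '' codes d n s L) (extend (2 * d + 1) '' codes d m s' L') := by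
  rw [Set.disjoint_left]
  rintro _ ⟨⟨e, p, t⟩, hx, rfl⟩ ⟨⟨e', p', t'⟩, hy, h⟩
  simp only [extend, Prod.mk.injEq, List.cons.injEq] at h
  omega

/-- The four parts of `codes_add_two` are disjoint and the maps are injective. Extended cardinality
makes a separate finiteness argument unnecessary. -/
theorem encard_codes (d n : ℕ) : ∀ (s : Bool) (L : List Bool),
    (codes d n s L).encard = (cnt d n s L : ℕ∞) := by
  induction n using Nat.strong_induction_on with
  | _ n ih =>
    intro s L
    match n, ih with
    | 0, _ => rw [codes_eq_empty (by omega)]; simp [cnt]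
    | 1, _ => rw [codes_eq_empty (by omega)]; simp [cnt]
    | n + 2, ih =>
      have hpair : (codes d n s L).encard + (codes d n (!s) L).encard =
          ((cnt d n true L + cnt d n false L : ℕ) : ℕ∞) := by
        rw [ih n (by omega), ih n (by omega)]
        cases s
        · rw [Bool.not_false, add_comm]; push_cast; rfl
        · rw [Bool.not_true]; push_cast; rfl
      rw [codes_add_two]
      cases L with
      | nil =>
        rw [switchCodes, Set.union_empty, Set.encard_union_eq, Set.encard_union_eq
          (disjoint_delay_extend (Or.inl rfl)), delay_injective.encard_image,
          (extend_injective 2).encard_image, hpair, encard_initialCodes_nil, cnt]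
        · push_cast; rfl
        · rw [Set.disjoint_left]
          rintro x (⟨y, hy, rfl⟩ | ⟨y, hy, rfl⟩) hx
          · have h1 := hy.1.1
            have h2 := one_le_lastTime hy.1.2.2
            have h3 := hx.2.2.1
            simp only [delay] at h3
            omega
          · have h1 := hx.1
            simp [extend] at h1
      | cons b L =>
        rw [initialCodes_cons, Set.union_empty, switchCodes, cnt]
        by_cases hb : b = s ∧ 2 * d ≤ n + 1
        · rw [if_pos ⟨hb.1, by omega⟩, if_pos hb, Set.encard_union_eq, Set.encard_union_eq
            (disjoint_delay_extend (Or.inl rfl)), delay_injective.encard_image,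
            (extend_injective 2).encard_image, hpair, (extend_injective _).encard_image,
            show n + 2 - (2 * d + 1) = n + 1 - 2 * d by omega, ih _ (by omega)]
          · push_cast; rfl
          · exact Set.disjoint_union_left.mpr
              ⟨disjoint_delay_extend (Or.inr rfl), disjoint_extend_extend⟩
        · rw [if_neg (fun h => hb ⟨h.1, by omega⟩), if_neg hb, Set.union_empty, Set.encard_union_eq
            (disjoint_delay_extend (Or.inl rfl)), delay_injective.encard_image,
            (extend_injective 2).encard_image, hpair, add_zero]

theorem ncard_codes (d n : ℕ) (s : Bool) (L : List Bool) :
    (codes d n s L).ncard = cnt d n s L := by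
  rw [Set.ncard, encard_codes]; rfl

/-! ### Counting homomorphisms -/

/-- The fibres of a map on a finite set have cardinalities adding up to that of the set. -/
theorem hasSum_ncard_fiber {α β : Type*} {S : Set α} (hS : S.Finite) (g : α → β) :
    HasSum (fun b => ((S ∩ g ⁻¹' {b}).ncard : ℝ)) S.ncard := by
  classical
  lift S to Finset α using hS
  have h1 : ∀ b, ((S : Set α) ∩ g ⁻¹' {b}).ncard = (S.filter (fun a => g a = b)).card := by
    intro b
    rw [← Set.ncard_coe_finset]
    congr 1
    ext a; simp
  simp only [h1, Set.ncard_coe_finset]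
  have h2 : (S.card : ℝ) = ∑ b ∈ S.image g, ((S.filter (fun a => g a = b)).card : ℝ) := by
    rw [Finset.card_eq_sum_card_image g S]; push_cast; rfl
  rw [h2]
  apply hasSum_sum_of_ne_finset_zero
  intro b hb
  rw [Nat.cast_eq_zero, Finset.card_eq_zero, Finset.filter_eq_empty_iff]
  intro a ha hab
  exact hb (Finset.mem_image.mpr ⟨a, ha, hab⟩)

theorem decode_mem_lineHom {d : ℕ} {l : List ℕ} (hl : IsCode d l) (n : ℕ) (e : Bool) :
    (fun i : Fin (n + 1) => decode e l i) ∈ lineHom n d := by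
  refine ⟨decode_zero d e l hl, ?_⟩
  rintro x y ⟨m, hm, h⟩
  rcases abs_cases (((x : ℕ) : ℤ) - ((y : ℕ) : ℤ)) with h1 | h1
  · have : (x : ℕ) = y + 2 * m + 1 := by omega
    simp only [this]
    exact decode_hom d e l hl y m hm
  · have : (y : ℕ) = x + 2 * m + 1 := by omega
    simp only [this]
    rw [abs_sub_comm]
    exact decode_hom d e l hl x m hm

theorem exists_code_of_mem_lineHom {n d : ℕ} (hn : 1 ≤ n) {f : Fin (n + 1) → ℤ}
    (hf : f ∈ lineHom n d) : ∃ e l, IsCode d l ∧ lastTime l ≤ n ∧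
      (fun i : Fin (n + 1) => decode e l i) = f := by
  obtain ⟨n, rfl⟩ : ∃ m, n = m + 1 := ⟨n - 1, by omega⟩
  let g : ℕ → ℤ := fun i => if h : i < n + 1 + 1 then f ⟨i, h⟩ else 0
  obtain ⟨e, l, h1, h2, h3⟩ := exists_decode d g (by simpa [g] using hf.1) n (by
    intro i m hm hi
    have := hf.2 ⟨i + 2 * m + 1, by omega⟩ ⟨i, by omega⟩ ⟨m, hm, by
      rw [abs_of_nonneg] <;> push_cast <;> linarith⟩
    simp only [g]
    rwa [dif_pos (by omega), dif_pos (by omega)])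
  refine ⟨e, l, h1, h2, ?_⟩
  ext i
  simp only [h3 i (by omega), g]
  rw [dif_pos i.2]

/-- The homomorphisms whose range has its size in `G`, up to the two without toggles, are counted
by their histories. -/
theorem hasSum_cnt_lineHom {n : ℕ} (d : ℕ) (hn : 1 ≤ n) (G : Set ℕ) [DecidablePred (· ∈ G)] :
    ∃ c : ℝ, 0 ≤ c ∧ c ≤ 2 ∧ HasSum (fun L => if histRange L + 2 ∈ G then
        ((cnt d n true L + cnt d n false L : ℕ) : ℝ) else 0)
      (({f | f ∈ lineHom n d ∧ rangeSize f ∈ G}.ncard : ℝ) - c) := by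
  classical
  let Φ : Bool × List ℕ → Fin (n + 1) → ℤ := fun x i => decode x.1 x.2 i
  let ι : Bool × ℕ × List ℕ → Bool × List ℕ := fun x => (x.1, x.2.1 :: x.2.2)
  let S : Set (Bool × ℕ × List ℕ) := {x | IsCode d (x.2.1 :: x.2.2) ∧ x.2.1 ≤ n ∧
    histRange (hist x.1 (x.2.1 :: x.2.2)) + 2 ∈ G}
  let A : Set (Bool × List ℕ) := {x | x.2 = [] ∧ rangeSize (Φ x) ∈ G}
  have hΦ : Set.InjOn Φ {x | IsCode d x.2 ∧ lastTime x.2 ≤ n} := by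
    rintro ⟨e, l⟩ ⟨h1, h2⟩ ⟨e', l'⟩ ⟨h1', h2'⟩ h
    obtain ⟨rfl, rfl⟩ := decode_injective d n hn e e' l l' h1 h1' h2 h2' (fun i hi =>
      congrFun h (⟨i, by omega⟩ : Fin (n + 1)))
    rfl
  have hι : Function.Injective ι := by
    rintro ⟨e, p, t⟩ ⟨e', p', t'⟩ h
    simpa [ι] using h
  have hSsub : ι '' S ⊆ {x | IsCode d x.2 ∧ lastTime x.2 ≤ n} := by
    rintro _ ⟨x, hx, rfl⟩; exact ⟨hx.1, hx.2.1⟩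
  have hAsub : A ⊆ {x | IsCode d x.2 ∧ lastTime x.2 ≤ n} := by
    rintro ⟨e, l⟩ ⟨h, -⟩
    simp only at h
    subst h
    exact ⟨trivial, hn⟩
  have hdisj : Disjoint A (ι '' S) := by
    rw [Set.disjoint_left]
    rintro _ ⟨h, -⟩ ⟨x, hx, rfl⟩
    simp [ι] at h
  have himg : {f | f ∈ lineHom n d ∧ rangeSize f ∈ G} = Φ '' (A ∪ ι '' S) := by
    ext f
    constructor
    · rintro ⟨hf, hG⟩
      obtain ⟨e, l, h1, h2, rfl⟩ := exists_code_of_mem_lineHom hn hf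
      refine ⟨(e, l), ?_, rfl⟩
      cases l with
      | nil => exact Or.inl ⟨rfl, hG⟩
      | cons p t =>
        right
        rw [rangeSize_decode h1 h2] at hG
        exact ⟨(e, p, t), ⟨h1, h2, hG⟩, rfl⟩
    · rintro ⟨x, hx | ⟨x, hx, rfl⟩, rfl⟩
      · exact ⟨decode_mem_lineHom (hAsub hx).1 n x.1, hx.2⟩
      · refine ⟨decode_mem_lineHom hx.1 n x.1, ?_⟩
        have := rangeSize_decode (e := x.1) hx.1 hx.2.1
        change rangeSize (fun i : Fin (n + 1) => decode x.1 (x.2.1 :: x.2.2) i) ∈ G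
        rw [this]
        exact hx.2.2
  have hA : A ⊆ {(true, []), (false, [])} := by
    rintro ⟨e, l⟩ ⟨h, -⟩
    simp only at h
    subst h
    cases e <;> simp
  have hAfin : A.Finite := (Set.toFinite _).subset hA
  have hAcard : A.ncard ≤ 2 := (Set.ncard_le_ncard hA).trans (Set.ncard_pair (by simp)).le
  have hinj : Set.InjOn Φ (A ∪ ι '' S) := hΦ.mono (Set.union_subset hAsub hSsub)
  have hfin : (A ∪ ι '' S).Finite := by
    apply Set.Finite.of_finite_image _ hinj
    rw [← himg]
    exact (lineHom_finite n d).subset fun f hf => hf.1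
  have hSfin : S.Finite :=
    Set.Finite.of_finite_image (hfin.subset Set.subset_union_right) hι.injOn
  have hcard : {f | f ∈ lineHom n d ∧ rangeSize f ∈ G}.ncard = A.ncard + S.ncard := by
    rw [himg, hinj.ncard_image, Set.ncard_union_eq hdisj hAfin
      (hfin.subset Set.subset_union_right), Set.ncard_image_of_injective _ hι]
  refine ⟨A.ncard, by positivity, by exact_mod_cast hAcard, ?_⟩
  rw [hcard]
  push_cast
  rw [add_sub_cancel_left]
  -- Sort the codes by history and last sign, then add the two signs.
  have hs := hasSum_ncard_fiber hSfin (fun x =>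
    (hist x.1 (x.2.1 :: x.2.2), lastSign x.1 (x.2.1 :: x.2.2)))
  have hs' := hs.prod_fiberwise (fun L => hasSum_fintype _)
  convert hs' using 1
  funext L
  rw [Fintype.sum_bool]
  have hfib : ∀ s, S ∩ (fun x : Bool × ℕ × List ℕ => (hist x.1 (x.2.1 :: x.2.2),
      lastSign x.1 (x.2.1 :: x.2.2))) ⁻¹' {(L, s)} =
      if histRange L + 2 ∈ G then codes d n s L else ∅ := by
    intro s
    ext x
    simp only [S, Set.mem_inter_iff, Set.mem_ofPred_eq, Set.mem_preimage, Set.mem_singleton_iff,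
      Prod.mk.injEq]
    split_ifs with h
    · constructor
      · rintro ⟨⟨h1, h2, -⟩, h3, h4⟩; exact ⟨h1, h2, h4, h3⟩
      · rintro ⟨h1, h2, h4, h3⟩; exact ⟨⟨h1, h2, by rwa [h3]⟩, h3, h4⟩
    · simp only [Set.mem_empty_iff_false, iff_false]
      rintro ⟨⟨h1, h2, h5⟩, h3, h4⟩
      rw [h3] at h5
      exact h h5
  rw [hfib, hfib]
  split_ifs
  · rw [ncard_codes, ncard_codes]
  · simp

/-! ### Asymptotics of the number of codes -/

theorem cnt_eq_zero (d n : ℕ) : ∀ (s : Bool) (L : List Bool), n < 2 * d * L.length + 2 →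
    cnt d n s L = 0 := by
  induction n using Nat.strong_induction_on with
  | _ n ih =>
    intro s L h
    match n, ih, L with
    | 0, _, _ => simp [cnt]
    | 1, _, _ => simp [cnt]
    | n + 2, _, [] => simp at h
    | n + 2, ih, b :: L =>
      rw [cnt, ih n (by omega) _ _ (by omega), ih n (by omega) _ _ (by omega)]
      split_ifs with hb
      · rw [ih _ (by omega)]
        rw [List.length_cons, Nat.mul_add] at h
        omega
      · rfl

/-- Removing the dead time 2d from every switch turns the recursion for d into the one for 0, so a
single sequence per history and sign has to be analysed. -/
theorem cnt_add (d n : ℕ) : ∀ (s : Bool) (L : List Bool),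
    cnt d (n + 2 * d * L.length) s L = cnt 0 n s L := by
  induction n using Nat.strong_induction_on with
  | _ n ih =>
    intro s L
    match n, ih, L with
    | 0, _, _ => rw [cnt_eq_zero _ _ _ _ (by omega), cnt_eq_zero _ _ _ _ (by omega)]
    | 1, _, _ => rw [cnt_eq_zero _ _ _ _ (by omega), cnt_eq_zero _ _ _ _ (by omega)]
    | n + 2, ih, [] =>
      have h1 := ih n (by omega) true []
      have h2 := ih n (by omega) false []
      simp only [List.length_nil, mul_zero, add_zero] at h1 h2 ⊢
      rw [cnt, cnt, h1, h2]
    | n + 2, ih, b :: L =>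
      have h1 := ih n (by omega) true (b :: L)
      have h2 := ih n (by omega) false (b :: L)
      have h3 := ih (n + 1) (by omega) s L
      rw [show n + 2 + 2 * d * (b :: L).length = n + 2 * d * (b :: L).length + 2 by ring, cnt, cnt,
        h1, h2]
      rw [List.length_cons, Nat.mul_add]
      have e1 : n + (2 * d * L.length + 2 * d * 1) + 1 - 2 * d = n + 1 + 2 * d * L.length := by
        omega
      rw [e1, h3]
      by_cases hb : b = s
      · rw [if_pos ⟨hb, by omega⟩, if_pos ⟨hb, by omega⟩]
        simp
      · rw [if_neg (fun h => hb h.1), if_neg (fun h => hb h.1)]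

/-- The limiting constant in the number of homomorphisms without switches. -/
noncomputable def theta (n : ℕ) : ℝ := if Even n then 3 / 2 else √2

theorem theta_congr {m n : ℕ} (h : Even m ↔ Even n) : theta m = theta n := by
  simp only [theta, h]

theorem theta_pos (n : ℕ) : 0 < theta n := by
  unfold theta; split_ifs <;> positivity

theorem theta_le (n : ℕ) : theta n ≤ 2 := by
  unfold theta
  split_ifs
  · norm_num
  · exact Real.sqrt_le_iff.mpr ⟨by norm_num, by norm_num⟩

theorem sqrt_two_pow_add_two (n : ℕ) : √2 ^ (n + 2) = 2 * √2 ^ n := by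
  rw [pow_add, Real.sq_sqrt (by norm_num), mul_comm]

/-- Both signs have the same count, so a(n+2) = 2a(n) + 2 and a + 2 doubles every two steps. The
values at 1 and 2 give the two constants of `theta`. -/
theorem cnt_nil (d : ℕ) (s : Bool) : ∀ n, 1 ≤ n → (cnt d n s [] : ℝ) + 2 = theta n * √2 ^ n
  | 1, _ => by
    simp only [cnt, theta]
    norm_num
  | 2, _ => by
    simp only [cnt, theta]
    norm_num
  | n + 3, _ => by
    have h1 := cnt_nil d true (n + 1) (by omega)
    have h2 := cnt_nil d false (n + 1) (by omega)
    have h3 : theta (n + 3) = theta (n + 1) := theta_congr (by simp only [Nat.even_iff]; omega)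
    rw [show n + 3 = n + 1 + 2 by rfl, cnt, sqrt_two_pow_add_two, min_eq_right (by omega)]
    rw [show n + 1 + 2 = n + 3 by rfl, h3]
    push_cast
    linarith

/-! ### Growth of the counts without dead time -/

section LittleO

open Asymptotics

theorem isLittleO_pow_succ (j : ℕ) :
    (fun n : ℕ => (n : ℝ) ^ j) =o[atTop] fun n : ℕ => (n : ℝ) ^ (j + 1) :=
  (isLittleO_pow_pow_atTop_of_lt (𝕜 := ℝ) (Nat.lt_succ_self j)).comp_tendsto
    tendsto_natCast_atTop_atTop

/-- Sum the increments along each parity class; m^(j+1) + m^j ≤ (m+2)^(j+1) absorbs one increment.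
-/
theorem isLittleO_of_sub_two {u : ℕ → ℝ} {j : ℕ}
    (h : (fun n => u (n + 2) - u n) =o[atTop] fun n : ℕ => (n : ℝ) ^ j) :
    u =o[atTop] fun n : ℕ => (n : ℝ) ^ (j + 1) := by
  rw [isLittleO_iff] at h ⊢
  intro ε hε
  obtain ⟨N, hN⟩ := eventually_atTop.mp (h (half_pos hε))
  set C := max |u N| |u (N + 1)|
  have key : ∀ n, N ≤ n → |u n| ≤ C + ε / 2 * (n : ℝ) ^ (j + 1) := by
    intro n
    induction n using Nat.strong_induction_on with
    | _ n ih =>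
      intro hn
      rcases Nat.lt_or_ge n (N + 2) with h' | h'
      · have hpos : 0 ≤ ε / 2 * (n : ℝ) ^ (j + 1) := by positivity
        rcases (by omega : n = N ∨ n = N + 1) with rfl | rfl
        · linarith [le_max_left |u n| |u (n + 1)|]
        · linarith [le_max_right |u N| |u (N + 1)|]
      · obtain ⟨m, rfl⟩ : ∃ m, n = m + 2 := ⟨n - 2, by omega⟩
        have h1 := ih m (by omega) (by omega)
        have h2 := hN m (by omega)
        rw [Real.norm_eq_abs, Real.norm_of_nonneg (by positivity)] at h2
        have h3 : |u (m + 2)| ≤ |u (m + 2) - u m| + |u m| := by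
          simpa using abs_add_le (u (m + 2) - u m) (u m)
        have h4 : (m : ℝ) ^ (j + 1) + (m : ℝ) ^ j ≤ ((m + 2 : ℕ) : ℝ) ^ (j + 1) := by
          push_cast
          have : (m : ℝ) ^ j ≤ ((m : ℝ) + 2) ^ j := by gcongr; linarith
          have h5 : (0 : ℝ) ≤ (m : ℝ) ^ j := by positivity
          have h6 : (m : ℝ) * (m : ℝ) ^ j ≤ (m : ℝ) * ((m : ℝ) + 2) ^ j := by gcongr
          rw [pow_succ, pow_succ]
          nlinarith
        nlinarith
  have hC : ∀ᶠ n : ℕ in atTop, C ≤ ε / 2 * (n : ℝ) ^ (j + 1) := by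
    have : Tendsto (fun n : ℕ => ε / 2 * (n : ℝ) ^ (j + 1)) atTop atTop :=
      ((tendsto_pow_atTop (Nat.succ_ne_zero j)).comp tendsto_natCast_atTop_atTop).const_mul_atTop
        (half_pos hε)
    exact this.eventually_ge_atTop C
  filter_upwards [hC, eventually_ge_atTop N] with n h1 h2
  have := key n h2
  rw [Real.norm_eq_abs, Real.norm_of_nonneg (by positivity)]
  linarith

theorem isBigO_add_two : (fun n : ℕ => (n : ℝ) + 2) =O[atTop] fun n : ℕ => (n : ℝ) := by
  refine IsBigO.of_bound 3 ?_
  filter_upwards [eventually_ge_atTop 1] with n hn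
  have : (1 : ℝ) ≤ n := by exact_mod_cast hn
  rw [Real.norm_of_nonneg (by positivity), Real.norm_of_nonneg (by positivity)]
  linarith

theorem isLittleO_pow_sub (j : ℕ) :
    (fun n : ℕ => ((n : ℝ) + 2) ^ (j + 1) - (n : ℝ) ^ (j + 1) - 2 * (j + 1) * (n : ℝ) ^ j)
      =o[atTop] fun n : ℕ => (n : ℝ) ^ j := by
  induction j with
  | zero =>
    have : (fun n : ℕ => ((n : ℝ) + 2) ^ (0 + 1) - (n : ℝ) ^ (0 + 1) -
        2 * ((0 : ℕ) + 1) * (n : ℝ) ^ 0) = fun _ => 0 := by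
      funext n; push_cast; ring
    rw [this]
    exact isLittleO_zero _ _
  | succ j ih =>
    have h1 := isBigO_add_two.mul_isLittleO ih
    have h2 := (isLittleO_pow_succ j).const_mul_left (4 * ((j : ℝ) + 1))
    have h3 : (fun n : ℕ => (n : ℝ) * (n : ℝ) ^ j) = fun n : ℕ => (n : ℝ) ^ (j + 1) := by
      funext n; ring
    rw [h3] at h1
    refine (h1.add h2).congr_left fun n => ?_
    push_cast
    ring

theorem isLittleO_pow_add_one (j : ℕ) :
    (fun n : ℕ => ((n : ℝ) + 1) ^ j - (n : ℝ) ^ j) =o[atTop] fun n : ℕ => (n : ℝ) ^ j := by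
  have h : (fun n : ℕ => (n : ℝ) + 1) ~[atTop] fun n : ℕ => (n : ℝ) := by
    have := (isLittleO_pow_succ 0)
    simp only [pow_zero, zero_add, pow_one] at this
    exact (IsEquivalent.refl (u := fun n : ℕ => (n : ℝ))).add_isLittleO this
  exact h.pow j

/-- The normalized number of codes with a given history. -/
noncomputable def ncnt (n : ℕ) (s : Bool) (L : List Bool) : ℝ := cnt 0 n s L / √2 ^ n

theorem ncnt_cons (n : ℕ) (s b : Bool) (L : List Bool) :
    ncnt (n + 2) s (b :: L) = (ncnt n true (b :: L) + ncnt n false (b :: L)) / 2 +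
      if b = s then ncnt (n + 1) s L / √2 else 0 := by
  unfold ncnt
  rw [cnt, sqrt_two_pow_add_two]
  have h2 : √2 * √2 = 2 := Real.mul_self_sqrt (by norm_num)
  by_cases hb : b = s
  · rw [if_pos ⟨hb, by omega⟩, if_pos hb, pow_succ]
    simp only [mul_zero, Nat.sub_zero]
    push_cast
    rw [div_div, mul_assoc, h2]
    field_simp
  · rw [if_neg (fun h => hb h.1), if_neg hb]
    push_cast
    field_simp
    ring

/-- The constant in the growth of the number of codes with `j` switches. -/
noncomputable def growth (j : ℕ) : ℝ := ((4 * √2) ^ j * (j.factorial : ℝ))⁻¹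

/-- A total 2B n^(j+1) over both signs has two-step increment about 4(j+1)B n^j, to be matched with
the contribution of histories of length j divided by √2. -/
theorem growth_succ (j : ℕ) : growth (j + 1) = growth j / √2 / (4 * (j + 1)) := by
  unfold growth
  rw [Nat.factorial_succ, pow_succ]
  push_cast
  field_simp

theorem isLittleO_mul_of_bounded {f g : ℕ → ℝ} {j : ℕ} {K : ℝ} (hg : ∀ n, |g n| ≤ K)
    (hf : f =o[atTop] fun n : ℕ => (n : ℝ) ^ j) :
    (fun n => g n * f n) =o[atTop] fun n : ℕ => (n : ℝ) ^ j := by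
  have : g =O[atTop] fun _ : ℕ => (1 : ℝ) :=
    IsBigO.of_bound K (Eventually.of_forall fun n => by simpa using hg n)
  simpa using this.mul_isLittleO hf

theorem abs_theta_le (n : ℕ) : |theta n| ≤ 2 := by
  rw [abs_of_pos (theta_pos n)]; exact theta_le n

/-- Induction on the history. The sum over both signs has explicit two-step increments and can be
summed; the recursion then gives each sign half of that sum, up to lower order. The contribution of
the shorter history enters at n+1, which shifts the argument of `theta` by one per switch. -/
theorem isLittleO_ncnt : ∀ (L : List Bool) (s : Bool),
    (fun n => ncnt n s L - theta (n + L.length) * growth L.length * (n : ℝ) ^ L.length)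
      =o[atTop] fun n : ℕ => (n : ℝ) ^ L.length
  | [], s => by
    simp only [List.length_nil, pow_zero, add_zero, growth, Nat.factorial_zero, Nat.cast_one,
      mul_one, inv_one]
    rw [isLittleO_one_iff]
    have h : Tendsto (fun n : ℕ => -2 * (√2 ^ n)⁻¹) atTop (𝓝 (-2 * 0)) := by
      refine Tendsto.const_mul _ (tendsto_inv_atTop_zero.comp
        (tendsto_pow_atTop_atTop_of_one_lt ?_))
      exact Real.lt_sqrt_of_sq_lt (by norm_num)
    rw [mul_zero] at h
    refine h.congr' ?_
    filter_upwards [eventually_ge_atTop 1] with n hn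
    have := cnt_nil 0 s n hn
    have hp : (0 : ℝ) < √2 ^ n := by positivity
    unfold ncnt
    rw [eq_sub_iff_add_eq, eq_div_iff hp.ne', add_mul, mul_assoc, inv_mul_cancel₀ hp.ne', ← this]
    ring
  | b :: L, s => by
    have ih := isLittleO_ncnt L b
    set j := L.length
    have hlen : (b :: L).length = j + 1 := rfl
    rw [hlen]
    -- one level up, at time `n + 1`
    have h1 : (fun n => ncnt (n + 1) b L - theta (n + (j + 1)) * growth j * (n : ℝ) ^ j)
        =o[atTop] fun n : ℕ => (n : ℝ) ^ j := by
      have e1 := ih.comp_tendsto (tendsto_add_atTop_nat 1)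
      have e2 : (fun n : ℕ => ((n + 1 : ℕ) : ℝ) ^ j) =O[atTop] fun n : ℕ => (n : ℝ) ^ j := by
        have := (isLittleO_pow_add_one j).isBigO.add (isBigO_refl (fun n : ℕ => (n : ℝ) ^ j) atTop)
        refine this.congr_left fun n => ?_
        push_cast; ring
      have e3 := isLittleO_mul_of_bounded (g := fun n => theta (n + (j + 1)) * growth j)
        (K := 2 * |growth j|) (fun n => by
          rw [abs_mul]; gcongr; exact abs_theta_le _) (isLittleO_pow_add_one j)
      refine ((e1.trans_isBigO e2).add e3).congr_left fun n => ?_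
      simp only [Function.comp]
      rw [show n + 1 + j = n + (j + 1) by ring]
      push_cast
      ring
    set B : ℕ → ℝ := fun n => theta (n + (j + 1)) * growth (j + 1)
    have hB : ∀ n, B (n + 2) = B n := fun n => by
      simp only [B]
      rw [theta_congr (n := n + (j + 1))]
      simp only [Nat.even_iff]; omega
    have hBb : ∀ n, |B n| ≤ 2 * |growth (j + 1)| := fun n => by
      simp only [B]
      rw [abs_mul]; gcongr; exact abs_theta_le _
    have hs2 : 0 < √2 := by positivity
    -- the total number, over both signs
    have h2 : (fun n => (ncnt n true (b :: L) + ncnt n false (b :: L)) -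
        2 * B n * (n : ℝ) ^ (j + 1)) =o[atTop] fun n : ℕ => (n : ℝ) ^ (j + 1) := by
      apply isLittleO_of_sub_two
      have e1 := h1.const_mul_left (√2)⁻¹
      have e2 := isLittleO_mul_of_bounded hBb (isLittleO_pow_sub j)
      refine (e1.sub (e2.const_mul_left 2)).congr_left fun n => ?_
      -- Only the sign `b` receives codes from the shorter history.
      have hrec : ncnt (n + 2) true (b :: L) + ncnt (n + 2) false (b :: L) =
          ncnt n true (b :: L) + ncnt n false (b :: L) + ncnt (n + 1) b L / √2 := by
        rw [ncnt_cons, ncnt_cons]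
        cases b <;> simp <;> ring
      rw [hB, hrec]
      simp only [B, growth_succ]
      push_cast
      field_simp
      ring
    have h3 : (fun n => ncnt (n + 1) s L) =o[atTop] fun n : ℕ => (n : ℝ) ^ (j + 1) := by
      have e0 : (fun n => ncnt (n + 1) s L - theta (n + 1 + j) * growth j * ((n + 1 : ℕ) : ℝ) ^ j)
          =o[atTop] fun n : ℕ => ((n + 1 : ℕ) : ℝ) ^ j :=
        (isLittleO_ncnt L s).comp_tendsto (tendsto_add_atTop_nat 1)
      have e2 : (fun n : ℕ => ((n + 1 : ℕ) : ℝ) ^ j) =O[atTop] fun n : ℕ => (n : ℝ) ^ j := by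
        have := (isLittleO_pow_add_one j).isBigO.add (isBigO_refl (fun n : ℕ => (n : ℝ) ^ j) atTop)
        refine this.congr_left fun n => ?_
        push_cast; ring
      have e3 := e2.trans_isLittleO (isLittleO_pow_succ j)
      have e4 := isLittleO_mul_of_bounded (g := fun n => theta (n + 1 + j) * growth j)
        (K := 2 * |growth j|) (fun n => by
          rw [abs_mul]; gcongr; exact abs_theta_le _) e3
      exact ((e0.trans e3).add e4).congr_left fun n => by ring
    -- shift by two
    have h4 : (fun n => ncnt (n + 2) s (b :: L) - B n * (n : ℝ) ^ (j + 1))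
        =o[atTop] fun n : ℕ => (n : ℝ) ^ (j + 1) := by
      have e1 := h2.const_mul_left (2 : ℝ)⁻¹
      by_cases hb : b = s
      · refine (e1.add (h3.const_mul_left (√2)⁻¹)).congr_left fun n => ?_
        rw [ncnt_cons, if_pos hb]
        ring
      · refine e1.congr_left fun n => ?_
        rw [ncnt_cons, if_neg hb]
        ring
    have h5 : (fun n => ncnt (n + 2) s (b :: L) - B (n + 2) * ((n + 2 : ℕ) : ℝ) ^ (j + 1))
        =o[atTop] fun n : ℕ => ((n + 2 : ℕ) : ℝ) ^ (j + 1) := by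
      have e1 : (fun n : ℕ => (n : ℝ) ^ (j + 1)) =O[atTop]
          fun n : ℕ => ((n + 2 : ℕ) : ℝ) ^ (j + 1) := by
        refine IsBigO.of_bound 1 (Eventually.of_forall fun n => ?_)
        rw [Real.norm_of_nonneg (by positivity), Real.norm_of_nonneg (by positivity), one_mul]
        push_cast
        gcongr
        linarith
      have e2 : (fun n : ℕ => ((n : ℝ) + 2) ^ (j + 1) - (n : ℝ) ^ (j + 1)) =o[atTop]
          fun n : ℕ => (n : ℝ) ^ (j + 1) := by
        have := ((isLittleO_pow_sub j).trans (isLittleO_pow_succ j)).add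
          ((isLittleO_pow_succ j).const_mul_left (2 * ((j : ℝ) + 1)))
        exact this.congr_left fun n => by ring
      have e3 := isLittleO_mul_of_bounded hBb e2
      refine ((h4.sub e3).trans_isBigO e1).congr_left fun n => ?_
      rw [hB]
      push_cast
      ring
    have h6 := h5.comp_tendsto (tendsto_sub_atTop_nat 2)
    refine h6.congr' ?_ ?_
    · filter_upwards [eventually_ge_atTop 2] with n hn
      simp only [Function.comp, Nat.sub_add_cancel hn]
      rfl
    · filter_upwards [eventually_ge_atTop 2] with n hn
      simp only [Function.comp, Nat.sub_add_cancel hn]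

end LittleO

/-! ### The critical regime -/

theorem tendsto_two_pow_atTop {lam : ℝ} (hlam : 0 < lam) {n d : ℕ → ℕ}
    (hn : Tendsto n atTop atTop)
    (hnd : Tendsto (fun k => (n k : ℝ) * ((2 : ℝ) ^ d k)⁻¹) atTop (𝓝 lam)) :
    Tendsto d atTop atTop := by
  have h1 : Tendsto (fun k => (n k : ℝ)) atTop atTop := tendsto_natCast_atTop_atTop.comp hn
  have h2 : Tendsto (fun k => (2 : ℝ) ^ d k) atTop atTop := by
    have h3 := h1.atTop_mul_pos (inv_pos.mpr hlam) (hnd.inv₀ hlam.ne')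
    refine h3.congr' ?_
    filter_upwards [h1.eventually_gt_atTop 0] with k hk
    field_simp
  rw [tendsto_atTop]
  intro b
  filter_upwards [h2.eventually_ge_atTop ((2 : ℝ) ^ b)] with k hk
  exact (pow_le_pow_iff_right₀ (by norm_num)).mp hk

/-- The number of codes with a given history in the critical regime. -/
theorem tendsto_cnt {lam : ℝ} (hlam : 0 < lam) {n d : ℕ → ℕ}
    (hn : Tendsto n atTop atTop)
    (hnd : Tendsto (fun k => (n k : ℝ) * ((2 : ℝ) ^ d k)⁻¹) atTop (𝓝 lam)) {r : ℕ}
    (hr : ∀ k, Even (n k) ↔ Even r) (s : Bool) (L : List Bool) :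
    Tendsto (fun k => (cnt (d k) (n k) s L : ℝ) / √2 ^ n k) atTop
      (𝓝 (theta (r + L.length) * growth L.length * lam ^ L.length)) := by
  have hd := tendsto_two_pow_atTop hlam hn hnd
  set j := L.length with hj
  have h1 : Tendsto (fun k => (d k : ℝ) * ((2 : ℝ) ^ d k)⁻¹) atTop (𝓝 0) := by
    have := (tendsto_pow_const_div_const_pow_of_one_lt 1 (one_lt_two (α := ℝ))).comp hd
    refine this.congr fun k => ?_
    simp only [Function.comp, pow_one]
    rfl
  -- The total dead time 2dj is negligible against n, since d 2^(-d) → 0.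
  have h2 : Tendsto (fun k => ((n k : ℝ) - 2 * d k * j) * ((2 : ℝ) ^ d k)⁻¹) atTop (𝓝 lam) := by
    have := hnd.sub (h1.const_mul (2 * (j : ℝ)))
    rw [mul_zero, sub_zero] at this
    exact this.congr fun k => by ring
  have hp2 : Tendsto (fun k => (2 : ℝ) ^ d k) atTop atTop :=
    (tendsto_pow_atTop_atTop_of_one_lt (by norm_num)).comp hd
  have h3 : Tendsto (fun k => (n k : ℝ) - 2 * d k * j) atTop atTop := by
    refine (h2.pos_mul_atTop hlam hp2).congr fun k => ?_
    rw [mul_assoc, inv_mul_cancel₀ (by positivity), mul_one]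
  have h4 : ∀ᶠ k in atTop, 2 * d k * j ≤ n k := by
    filter_upwards [h3.eventually_ge_atTop 0] with k hk
    have : ((2 * d k * j : ℕ) : ℝ) ≤ n k := by push_cast; linarith
    exact_mod_cast this
  have h5 : Tendsto (fun k => n k - 2 * d k * j) atTop atTop := by
    rw [← tendsto_natCast_atTop_iff (R := ℝ)]
    refine h3.congr' ?_
    filter_upwards [h4] with k hk
    push_cast [Nat.cast_sub hk]
    ring
  have h6 := (isLittleO_ncnt L s).tendsto_div_nhds_zero.comp h5
  have h7 : Tendsto (fun k => (((n k : ℝ) - 2 * d k * j) * ((2 : ℝ) ^ d k)⁻¹) ^ j) atTop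
      (𝓝 (lam ^ j)) := h2.pow j
  have h8 := (h6.add_const (theta (r + j) * growth j)).mul h7
  rw [zero_add] at h8
  refine h8.congr' ?_
  filter_upwards [h4, h5.eventually_gt_atTop 0] with k hk hk0
  obtain ⟨m, hm⟩ : ∃ m, n k = m + 2 * d k * j := ⟨n k - 2 * d k * j, by omega⟩
  have hm0 : 0 < m := by omega
  have hth : theta (m + j) = theta (r + j) := by
    apply theta_congr
    have := hr k
    rw [hm, mul_assoc] at this
    simp only [Nat.even_iff] at this ⊢
    omega
  simp only [Function.comp, ← hj]
  rw [hm, cnt_add, Nat.add_sub_cancel, hth]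
  have hmr : (0 : ℝ) < m := by exact_mod_cast hm0
  -- The dead time contributes √2^(2dj) = (2^d)^j, which turns m^j into (m 2^(-d))^j.
  have hpw : √2 ^ (m + 2 * d k * j) = √2 ^ m * ((2 : ℝ) ^ d k) ^ j := by
    rw [pow_add, mul_assoc 2, pow_mul, Real.sq_sqrt (by norm_num), pow_mul]
  rw [hpw]
  unfold ncnt
  push_cast
  rw [add_sub_cancel_right, mul_pow, inv_pow]
  field_simp
  ring

theorem pow_add_mul_pow_le {x h : ℝ} (hx : 0 ≤ x) (hh : 0 ≤ h) (j : ℕ) :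
    x ^ (j + 1) + (j + 1) * (h * x ^ j) ≤ (x + h) ^ (j + 1) := by
  induction j with
  | zero => simp
  | succ j ih =>
    have h1 : 0 ≤ x ^ j := by positivity
    have h2 : (x ^ (j + 1) + (j + 1) * (h * x ^ j)) * (x + h) ≤ (x + h) ^ (j + 1 + 1) := by
      rw [pow_succ (x + h) (j + 1)]; gcongr
    have h3 : 0 ≤ ((j : ℝ) + 1) * h * h * x ^ j := by positivity
    push_cast
    rw [pow_succ x j] at h2 ⊢
    rw [pow_succ x (j + 1), pow_succ x j]
    nlinarith

/-- Supplies the summable majorant. With x = n 2^(-d) and h = 2^(-d), the recursion adds (j+1) h x^j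
to x^(j+1), which `pow_add_mul_pow_le` bounds by (x+h)^(j+1). -/
theorem cnt_le {d : ℕ} (hd : 1 ≤ d) (n : ℕ) : ∀ (s : Bool) (L : List Bool),
    (cnt d n s L : ℝ) ≤ 2 * √2 ^ n * ((n : ℝ) * ((2 : ℝ) ^ d)⁻¹) ^ L.length /
      (L.length.factorial : ℝ) := by
  induction n using Nat.strong_induction_on with
  | _ n ih =>
    intro s L
    match n, ih, L with
    | 0, _, _ => simp only [cnt, Nat.cast_zero]; positivity
    | 1, _, _ => simp only [cnt, Nat.cast_zero]; positivity
    | n + 2, ih, [] =>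
      have h := cnt_nil d s (n + 2) (by omega)
      have h' := mul_le_mul_of_nonneg_right (theta_le (n + 2)) (by positivity : 0 ≤ √2 ^ (n + 2))
      simp only [List.length_nil, pow_zero, Nat.factorial_zero, Nat.cast_one, mul_one, div_one]
      linarith
    | n + 2, ih, b :: L =>
      rw [cnt, List.length_cons]
      have e1 := ih n (by omega) true (b :: L)
      have e2 := ih n (by omega) false (b :: L)
      rw [List.length_cons] at e1 e2
      set j := L.length
      set h : ℝ := ((2 : ℝ) ^ d)⁻¹ with hh
      have hpos : 0 < h := by positivity
      have e3 : ((if b = s ∧ 2 * d ≤ n + 1 then cnt d (n + 1 - 2 * d) s L else 0 : ℕ) : ℝ) ≤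
          2 * √2 ^ (n + 2) * (h * ((n : ℝ) * h) ^ j) / (j.factorial : ℝ) := by
        split_ifs with hb
        · refine (ih _ (by omega) s L).trans ?_
          have f1 : √2 ^ (n + 1 - 2 * d) ≤ √2 ^ (n + 2) * h := by
            have : √2 ^ (n + 2) = √2 ^ (n + 1 - 2 * d) * √2 * 2 ^ d := by
              rw [show n + 2 = (n + 1 - 2 * d) + 1 + 2 * d by omega, pow_add, pow_mul √2 2 d,
                Real.sq_sqrt (by norm_num), pow_succ]
            rw [this, hh, mul_assoc, mul_inv_cancel₀ (by positivity), mul_one]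
            have : 1 ≤ √2 := Real.one_le_sqrt.mpr (by norm_num)
            exact le_mul_of_one_le_right (by positivity) this
          have f2 : ((n + 1 - 2 * d : ℕ) : ℝ) ≤ n := by
            exact_mod_cast (by omega : n + 1 - 2 * d ≤ n)
          calc 2 * √2 ^ (n + 1 - 2 * d) * (((n + 1 - 2 * d : ℕ) : ℝ) * h) ^ j / (j.factorial : ℝ)
              ≤ 2 * (√2 ^ (n + 2) * h) * ((n : ℝ) * h) ^ j / (j.factorial : ℝ) := by gcongr
            _ = _ := by ring
        · simp only [Nat.cast_zero]; positivity
      have e4 := pow_add_mul_pow_le (x := (n : ℝ) * h) (h := h) (by positivity) hpos.le j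
      have e5 : ((n : ℝ) * h + h) ^ (j + 1) ≤ (((n + 2 : ℕ) : ℝ) * h) ^ (j + 1) := by
        gcongr
        push_cast
        nlinarith
      have hf : (((j + 1).factorial : ℕ) : ℝ) = (j + 1) * (j.factorial : ℝ) := by
        rw [Nat.factorial_succ]; push_cast; ring
      rw [Nat.cast_add, Nat.cast_add]
      refine (add_le_add (add_le_add e1 e2) e3).trans ?_
      rw [hf, sqrt_two_pow_add_two]
      rw [← add_div, div_add_div _ _ (by positivity) (by positivity),
        div_le_div_iff₀ (by positivity) (by positivity)]
      have e6 := e4.trans e5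
      have hA : 0 < √2 ^ n := by positivity
      have hF : (0 : ℝ) < j.factorial := by positivity
      have e7 := mul_le_mul_of_nonneg_left e6
        (by positivity : 0 ≤ 4 * √2 ^ n * ((j : ℝ) + 1) * j.factorial * j.factorial)
      nlinarith [e7]

/-! ### Sums over histories -/

theorem hasSum_list_length {a : ℕ → ℝ} (ha : ∀ j, 0 ≤ a j) {S : ℝ}
    (h : HasSum (fun j => 2 ^ j * a j) S) : HasSum (fun L : List Bool => a L.length) S := by
  rw [← (List.equivSigmaTuple (α := Bool)).symm.hasSum_iff]
  have hlen : ∀ x : Σ n, Fin n → Bool, ((List.equivSigmaTuple (α := Bool)).symm x).length = x.1 :=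
    fun x => by simp [List.equivSigmaTuple]
  have hf : ∀ j : ℕ, HasSum (fun _ : Fin j → Bool => a j) (2 ^ j * a j) := by
    intro j
    have := hasSum_fintype (fun _ : Fin j → Bool => a j)
    simpa using this
  have hsum : Summable (fun x : Σ n, Fin n → Bool => a x.1) := by
    rw [summable_sigma_of_nonneg (fun x => ha x.1)]
    refine ⟨fun j => (hf j).summable, ?_⟩
    simp only [(hf _).tsum_eq]
    exact h.summable
  have : (fun L : List Bool => a L.length) ∘ (List.equivSigmaTuple (α := Bool)).symm =
      fun x : Σ n, Fin n → Bool => a x.1 := by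
    funext x
    simp only [Function.comp, hlen]
  rw [this]
  exact HasSum.sigma_of_hasSum h hf hsum

/-- The number of homomorphisms with range size in a given set in the critical regime. -/
theorem tendsto_ncard_lineHom {lam : ℝ} (hlam : 0 < lam) {n d : ℕ → ℕ}
    (hn : Tendsto n atTop atTop)
    (hnd : Tendsto (fun k => (n k : ℝ) * ((2 : ℝ) ^ d k)⁻¹) atTop (𝓝 lam)) {r : ℕ}
    (hr : ∀ k, Even (n k) ↔ Even r) (G : Set ℕ) [DecidablePred (· ∈ G)] :
    Tendsto (fun k => ({f | f ∈ lineHom (n k) (d k) ∧ rangeSize f ∈ G}.ncard : ℝ) / √2 ^ n k) atTop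
      (𝓝 (∑' L : List Bool, if histRange L + 2 ∈ G then
        2 * (theta (r + L.length) * growth L.length * lam ^ L.length) else 0)) := by
  have hd := tendsto_two_pow_atTop hlam hn hnd
  let F : ℕ → List Bool → ℝ := fun k L => if histRange L + 2 ∈ G then
    ((cnt (d k) (n k) true L + cnt (d k) (n k) false L : ℕ) : ℝ) / √2 ^ n k else 0
  -- Eventually n 2^(-d) ≤ λ + 1, and each of the two signs contributes a factor 2 from `cnt_le`.
  -- The 2^j histories of length j do not spoil summability.
  have hbound : Summable (fun L : List Bool =>
      4 * (lam + 1) ^ L.length / (L.length.factorial : ℝ)) := by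
    refine (hasSum_list_length (a := fun j => 4 * (lam + 1) ^ j / (j.factorial : ℝ))
      (fun j => by positivity) (S := ∑' j : ℕ, 2 ^ j * (4 * (lam + 1) ^ j / (j.factorial : ℝ)))
      (Summable.hasSum ?_)).summable
    refine ((Real.summable_pow_div_factorial (2 * (lam + 1))).mul_left 4).congr fun j => ?_
    rw [mul_pow]; ring
  have hT : Tendsto (fun k => ∑' L, F k L) atTop (𝓝 (∑' L : List Bool,
      if histRange L + 2 ∈ G then
        2 * (theta (r + L.length) * growth L.length * lam ^ L.length) else 0)) := by
    refine tendsto_tsum_of_dominated_convergence hbound (fun L => ?_) ?_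
    · simp only [F]
      split_ifs
      · have := (tendsto_cnt hlam hn hnd hr true L).add (tendsto_cnt hlam hn hnd hr false L)
        rw [← two_mul] at this
        refine this.congr fun k => ?_
        push_cast
        ring
      · exact tendsto_const_nhds
    · filter_upwards [hnd.eventually_le_const (lt_add_one lam), hd.eventually_ge_atTop 1]
        with k h1 h2 L
      simp only [F]
      split_ifs
      · rw [Real.norm_of_nonneg (by positivity), div_le_iff₀ (by positivity)]
        have e1 := cnt_le h2 (n k) true L
        have e2 := cnt_le h2 (n k) false L
        have e3 : 2 * √2 ^ n k * ((n k : ℝ) * ((2 : ℝ) ^ d k)⁻¹) ^ L.length /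
            (L.length.factorial : ℝ) ≤
            2 * √2 ^ n k * (lam + 1) ^ L.length / (L.length.factorial : ℝ) := by
          gcongr
        have e4 : 4 * (lam + 1) ^ L.length / (L.length.factorial : ℝ) * √2 ^ n k =
            2 * (2 * √2 ^ n k * (lam + 1) ^ L.length / (L.length.factorial : ℝ)) := by ring
        rw [e4]
        push_cast
        linarith
      · rw [norm_zero]; positivity
  have hpow : Tendsto (fun k => √2 ^ n k) atTop atTop :=
    (tendsto_pow_atTop_atTop_of_one_lt (Real.lt_sqrt_of_sq_lt (by norm_num))).comp hn
  -- The error is the at most two toggle-free functions, divided by √2^n.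
  have h0 : Tendsto (fun k => ({f | f ∈ lineHom (n k) (d k) ∧ rangeSize f ∈ G}.ncard : ℝ) /
      √2 ^ n k - ∑' L, F k L) atTop (𝓝 0) := by
    have h2 : Tendsto (fun k => 2 / √2 ^ n k) atTop (𝓝 0) := hpow.const_div_atTop 2
    refine squeeze_zero_norm' ?_ h2
    filter_upwards [hn.eventually_ge_atTop 1] with k hk
    obtain ⟨c, hc0, hc2, hs⟩ := hasSum_cnt_lineHom (d k) hk G
    have hF : HasSum (F k) ((({f | f ∈ lineHom (n k) (d k) ∧ rangeSize f ∈ G}.ncard : ℝ) - c) /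
        √2 ^ n k) := by
      refine Eq.subst (motive := fun f => HasSum f _) (funext fun L => ?_)
        (hs.div_const (√2 ^ n k))
      simp only [F]
      split_ifs <;> simp
    rw [hF.tsum_eq, ← sub_div, sub_sub_cancel, Real.norm_of_nonneg (by positivity)]
    gcongr
  simpa using h0.add hT

/-- Writing the total number as the count for `Set.univ` lets one limit theorem treat numerator and
denominator. -/
theorem lineHomMeasure_real (n d : ℕ) (G : Set ℕ) :
    (lineHomMeasure n d).real (rangeSize ⁻¹' G) =
      ({f | f ∈ lineHom n d ∧ rangeSize f ∈ G}.ncard : ℝ) /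
        ({f | f ∈ lineHom n d ∧ rangeSize f ∈ Set.univ}.ncard : ℝ) := by
  have h1 : {f | f ∈ lineHom n d ∧ rangeSize f ∈ Set.univ} = lineHom n d := by
    ext f; simp
  have h2 : {f | f ∈ lineHom n d ∧ rangeSize f ∈ G} = lineHom n d ∩ rangeSize ⁻¹' G := by
    ext f; rfl
  have hfin := lineHom_finite n d
  rw [h1, h2, measureReal_def, lineHomMeasure, uniformOn, cond_apply hfin.measurableSet,
    Measure.count_apply_finite _ hfin, Measure.count_apply_finite _ (hfin.inter_of_left _),
    Set.ncard_eq_toFinset_card _ hfin, Set.ncard_eq_toFinset_card _ (hfin.inter_of_left _),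
    ENNReal.toReal_mul, ENNReal.toReal_inv, ENNReal.toReal_natCast, ENNReal.toReal_natCast]
  rw [div_eq_mul_inv, mul_comm]

/-! ### The limit law -/

/-- A function which is constant on the parts of a countable partition has a law which is
determined by the probabilities of the parts. -/
theorem hasSum_measureReal_preimage {Ω β ι : Type*} [MeasurableSpace Ω] [Countable ι]
    {μ : Measure Ω} [IsFiniteMeasure μ] {E : ι → Set Ω} (hE : ∀ i, MeasurableSet (E i))
    (hdisj : Pairwise (Function.onFun Disjoint E)) (hcov : μ (⋃ i, E i)ᶜ = 0) {φ : Ω → β}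
    {g : ι → β} (hφ : ∀ i, ∀ ω ∈ E i, φ ω = g i) (S : Set β) [DecidablePred (· ∈ S)] :
    HasSum (fun i => if g i ∈ S then μ.real (E i) else 0) (μ.real (φ ⁻¹' S)) := by
  have h1 : ∀ i, φ ⁻¹' S ∩ E i = if g i ∈ S then E i else ∅ := by
    intro i
    ext ω
    simp only [Set.mem_inter_iff, Set.mem_preimage]
    split_ifs with h
    · exact ⟨fun h' => h'.2, fun h' => ⟨by rwa [hφ i ω h'], h'⟩⟩
    · simp only [Set.mem_empty_iff_false, iff_false]
      rintro ⟨h2, h3⟩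
      rw [hφ i ω h3] at h2
      exact h h2
  have h2 : μ (φ ⁻¹' S) = ∑' i, μ (φ ⁻¹' S ∩ E i) := by
    rw [← measure_inter_conull hcov, Set.inter_iUnion, measure_iUnion]
    · intro i j hij
      exact (hdisj hij).mono Set.inter_subset_right Set.inter_subset_right
    · intro i
      rw [h1]
      split_ifs
      exacts [hE i, MeasurableSet.empty]
  have h3 := ENNReal.hasSum_toReal (h2 ▸ measure_ne_top μ _)
  rw [← ENNReal.tsum_toReal_eq (fun i => measure_ne_top μ _), ← h2] at h3
  refine Eq.subst (motive := fun f => HasSum f _) (funext fun i => ?_) h3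
  rw [h1]
  split_ifs <;> simp [measureReal_def]

theorem hasSum_even_poisson (x : ℝ) :
    HasSum (fun k : ℕ => if Even k then x ^ k / (k.factorial : ℝ) else 0) (Real.cosh x) := by
  have h1 := Real.hasSum_cosh x
  rw [← add_zero (Real.cosh x)]
  refine HasSum.even_add_odd ?_ ?_
  · simpa using h1
  · simp

theorem hasSum_odd_poisson (x : ℝ) :
    HasSum (fun k : ℕ => if Odd k then x ^ k / (k.factorial : ℝ) else 0) (Real.sinh x) := by
  have h1 := Real.hasSum_sinh x
  rw [← zero_add (Real.sinh x)]
  refine HasSum.even_add_odd ?_ ?_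
  · have h2 : ∀ k, ¬ Odd (2 * k) := fun k => by rw [Nat.not_odd_iff_even]; exact even_two_mul k
    simp only [h2, if_false]
    exact hasSum_zero
  · simpa using h1

theorem hasSum_poissonMeasure_real {x : ℝ} (hx : 0 < x) (S : Set ℕ) [DecidablePred (· ∈ S)] :
    HasSum (fun k => if k ∈ S then Real.exp (-x) * (x ^ k / (k.factorial : ℝ)) else 0)
      ((poissonMeasure x.toNNReal).real S) := by
  have := hasSum_measureReal_preimage (μ := poissonMeasure x.toNNReal) (E := fun k : ℕ => {k})
    (fun _ => MeasurableSet.singleton _)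
    (fun i j hij => Set.disjoint_singleton.mpr hij) (by
      rw [Set.iUnion_of_singleton]; simp) (φ := id) (g := id) (fun i ω h => h) S
  simp only [poissonMeasure_real_singleton, id, Set.preimage_id, Real.coe_toNNReal x hx.le] at this
  simpa only [mul_div_assoc] using this

theorem poissonMeasure_real_even {x : ℝ} (hx : 0 < x) :
    (poissonMeasure x.toNNReal).real {k | Even k} = Real.exp (-x) * Real.cosh x := by
  classical
  refine (hasSum_poissonMeasure_real hx {k | Even k}).unique ?_
  refine Eq.subst (motive := fun f => HasSum f _) (funext fun k => ?_)
    ((hasSum_even_poisson x).mul_left (Real.exp (-x)))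
  simp

theorem poissonMeasure_real_odd {x : ℝ} (hx : 0 < x) :
    (poissonMeasure x.toNNReal).real {k | Odd k} = Real.exp (-x) * Real.sinh x := by
  classical
  refine (hasSum_poissonMeasure_real hx {k | Odd k}).unique ?_
  refine Eq.subst (motive := fun f => HasSum f _) (funext fun k => ?_)
    ((hasSum_odd_poisson x).mul_left (Real.exp (-x)))
  simp

theorem cond_poissonMeasure_singleton {x : ℝ} (hx : 0 < x) (S : Set ℕ) (k : ℕ)
    [Decidable (k ∈ S)] :
    ((cond (poissonMeasure x.toNNReal) S) {k}).toReal =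
      if k ∈ S then Real.exp (-x) * (x ^ k / (k.factorial : ℝ)) /
        (poissonMeasure x.toNNReal).real S else 0 := by
  rw [cond_apply (MeasurableSet.of_discrete), ENNReal.toReal_mul, ENNReal.toReal_inv]
  split_ifs with h
  · rw [Set.inter_eq_right.mpr (Set.singleton_subset_iff.mpr h), ← measureReal_def,
      ← measureReal_def, poissonMeasure_real_singleton, Real.coe_toNNReal x hx.le]
    ring
  · rw [Set.inter_singleton_eq_empty.mpr h]
    simp

/-- The point probabilities of a parity-biased Poisson distribution. -/
theorem parityBiasedPoisson_real_singleton {x a : ℝ} (hx : 0 < x) (ha : 0 < a) (k : ℕ) :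
    (parityBiasedPoisson x a).real {k} = (if Even k then a else 1) * (x ^ k / (k.factorial : ℝ)) /
      (a * Real.cosh x + Real.sinh x) := by
  classical
  have hc := Real.cosh_pos x
  have hs := Real.sinh_pos_iff.mpr hx
  have ht : 0 < Real.tanh x := by
    rw [Real.tanh_eq_sinh_div_cosh]; exact div_pos hs hc
  have he := Real.exp_pos (-x)
  rw [measureReal_def, parityBiasedPoisson, Measure.add_apply, Measure.smul_apply,
    Measure.smul_apply, ENNReal.toReal_add, smul_eq_mul, smul_eq_mul, ENNReal.toReal_mul,
    ENNReal.toReal_mul, ENNReal.toReal_ofReal (by positivity),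
    ENNReal.toReal_ofReal (by positivity), cond_poissonMeasure_singleton hx,
    cond_poissonMeasure_singleton hx, poissonMeasure_real_even hx, poissonMeasure_real_odd hx]
  · simp only [Set.mem_ofPred_eq, ← Nat.not_even_iff_odd]
    rw [Real.tanh_eq_sinh_div_cosh]
    by_cases h : Even k
    · simp only [h, if_true, not_true_eq_false, if_false]
      field_simp
      ring
    · simp only [h, if_false, not_false_eq_true, if_true]
      field_simp
      ring
  · rw [smul_eq_mul]; exact ENNReal.mul_ne_top ENNReal.ofReal_ne_top (measure_ne_top _ _)
  · rw [smul_eq_mul]; exact ENNReal.mul_ne_top ENNReal.ofReal_ne_top (measure_ne_top _ _)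

theorem hasSum_parityBiasedPoisson {x a : ℝ} (hx : 0 < x) (ha : 0 < a) :
    HasSum (fun k => (parityBiasedPoisson x a).real {k}) 1 := by
  have := isProbabilityMeasure_parityBiasedPoisson hx ha
  classical
  have := hasSum_measureReal_preimage (μ := parityBiasedPoisson x a) (E := fun k : ℕ => {k})
    (fun _ => MeasurableSet.singleton _)
    (fun i j hij => Set.disjoint_singleton.mpr hij) (by
      rw [Set.iUnion_of_singleton]; simp) (φ := id) (g := id) (fun i ω h => h) Set.univ
  simpa using this

/-! ### The random walk stopped at an independent time -/

theorem stepMeasure_sgn (b : Bool) : stepMeasure {sgn b} = 2⁻¹ := by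
  rw [stepMeasure, PMF.toMeasure_apply_singleton _ _ (MeasurableSet.singleton _)]
  exact (PMF.uniformOfFinset_apply_of_mem _ (by cases b <;> simp [sgn])).trans (by simp)

/-- The step sequences starting with the given signs. -/
def cylinderSet (L : List Bool) : Set (ℕ → ℤ) :=
  Set.pi (Finset.range L.length) fun i => {sgn (L.getD i true)}

theorem measurableSet_cylinderSet (L : List Bool) : MeasurableSet (cylinderSet L) :=
  MeasurableSet.pi (Finset.countable_toSet _) fun _ _ => MeasurableSet.singleton _

theorem stepsMeasure_cylinderSet (L : List Bool) :
    stepsMeasure (cylinderSet L) = 2⁻¹ ^ L.length := by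
  rw [cylinderSet, stepsMeasure, Measure.infinitePi_pi _ (fun _ _ => MeasurableSet.singleton _)]
  simp only [stepMeasure_sgn, Finset.prod_const, Finset.card_range]

theorem walk_succ (ξ : ℕ → ℤ) (i : ℕ) : walk ξ (i + 1) = ξ 0 + walk (fun j => ξ (j + 1)) i := by
  rw [walk, Finset.sum_range_succ', add_comm, walk]

/-- Here the head of `L` is the first step, while `lowest` and `highest` treat it as the last step
and measure from the endpoint. Reversing time negates positions, so the two extremes exchange roles.
-/
theorem exists_walk_eq_iff : ∀ (L : List Bool) (ξ : ℕ → ℤ), ξ ∈ cylinderSet L → ∀ z,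
    (∃ i, i ≤ L.length ∧ z = walk ξ i) ↔ -highest L ≤ z ∧ z ≤ -lowest L
  | [], ξ, _, z => by
    simp only [List.length_nil, highest, lowest, nonpos_iff_eq_zero, exists_eq_left]
    simp only [walk, Finset.range_zero, Finset.sum_empty]
    omega
  | b :: L, ξ, hξ, z => by
    have h0 : ξ 0 = sgn b := by
      simpa using hξ 0 (by simp)
    have h1 : (fun j => ξ (j + 1)) ∈ cylinderSet L := by
      intro i hi
      have := hξ (i + 1) (by simpa using hi)
      simpa using this
    have ih := exists_walk_eq_iff L _ h1 (z - sgn b)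
    have step : (∃ i, i ≤ (b :: L).length ∧ z = walk ξ i) ↔ z = 0 ∨
        ∃ i, i ≤ L.length ∧ z - sgn b = walk (fun j => ξ (j + 1)) i := by
      constructor
      · rintro ⟨i, hi, hz⟩
        cases i with
        | zero => left; simpa [walk] using hz
        | succ i =>
          right
          rw [walk_succ, h0] at hz
          exact ⟨i, by simpa using hi, by linarith⟩
      · rintro (rfl | ⟨i, hi, hz⟩)
        · exact ⟨0, by omega, by simp [walk]⟩
        · exact ⟨i + 1, by simpa using hi, by rw [walk_succ, h0]; linarith⟩
    rw [step, ih]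
    simp only [highest, lowest]
    have hlo := lowest_nonpos L
    have hhi := highest_nonneg L
    rcases sgn_cases b with hs | hs <;> rw [hs] <;> omega

theorem walkRangeSize_eq {L : List Bool} {ξ : ℕ → ℤ} (hξ : ξ ∈ cylinderSet L) :
    walkRangeSize ξ L.length = histRange L := by
  have : {s : ℤ | ∃ i : ℕ, i ≤ L.length ∧ s = walk ξ i} =
      ((Finset.Icc (-highest L) (-lowest L) : Finset ℤ) : Set ℤ) := by
    ext z
    rw [Finset.coe_Icc, Set.mem_Icc, ← exists_walk_eq_iff L ξ hξ z]
    rfl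
  rw [walkRangeSize, this, Set.ncard_coe_finset, Int.card_Icc, histRange]
  congr 1
  ring

theorem disjoint_cylinderSet_prod :
    Pairwise (Function.onFun Disjoint
      fun L : List Bool => cylinderSet L ×ˢ ({L.length} : Set ℕ)) := by
  intro L L' hne
  rw [Function.onFun, Set.disjoint_left]
  rintro ⟨ξ, k⟩ ⟨h1, h2⟩ ⟨h3, h4⟩
  simp only [Set.mem_singleton_iff] at h2 h4
  have hlen : L.length = L'.length := h2.symm.trans h4
  apply hne
  refine List.ext_getElem hlen fun i hi hi' => ?_
  have e1 := h1 i (by simpa using hi)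
  have e2 := h3 i (by simpa using hi')
  simp only [Set.mem_singleton_iff] at e1 e2
  have := sgn_injective (e1.symm.trans e2)
  rwa [List.getD_eq_getElem _ _ hi, List.getD_eq_getElem _ _ hi'] at this

/-- The law of the range size of the walk at an independent time. -/
theorem hasSum_walkTimeMeasure {x a : ℝ} (hx : 0 < x) (ha : 0 < a) (S : Set ℕ)
    [DecidablePred (· ∈ S)] :
    HasSum (fun L : List Bool => if histRange L + 2 ∈ S then
        (parityBiasedPoisson x a).real {L.length} * (2⁻¹) ^ L.length else 0)
      ((walkTimeMeasure (parityBiasedPoissonLaw x a hx ha)).real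
        ((fun ω : (ℕ → ℤ) × ℕ => walkRangeSize ω.1 ω.2 + 2) ⁻¹' S)) := by
  set μ := walkTimeMeasure (parityBiasedPoissonLaw x a hx ha)
  let E : List Bool → Set ((ℕ → ℤ) × ℕ) := fun L => cylinderSet L ×ˢ ({L.length} : Set ℕ)
  have hE : ∀ L, MeasurableSet (E L) := fun L =>
    (measurableSet_cylinderSet L).prod (MeasurableSet.singleton _)
  have hmass : ∀ L, μ.real (E L) =
      (parityBiasedPoisson x a).real {L.length} * (2⁻¹) ^ L.length := by
    intro L
    simp only [μ, E, walkTimeMeasure, measureReal_def, Measure.prod_prod,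
      stepsMeasure_cylinderSet, ENNReal.toReal_mul, ENNReal.toReal_pow, ENNReal.toReal_inv,
      ENNReal.toReal_ofNat]
    rw [mul_comm]
    rfl
  have hone : HasSum (fun L => μ.real (E L)) 1 := by
    simp only [hmass]
    refine hasSum_list_length (a := fun j => (parityBiasedPoisson x a).real {j} * (2⁻¹) ^ j)
      (fun j => by positivity) ?_
    convert hasSum_parityBiasedPoisson hx ha using 1
    funext j
    rw [mul_comm, mul_assoc, ← mul_pow]
    norm_num
  -- The masses of the pieces already add up to 1, so step sequences with values other than ±1 need
  -- no separate treatment.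
  have hcov : μ (⋃ L, E L)ᶜ = 0 := by
    rw [prob_compl_eq_zero_iff (MeasurableSet.iUnion hE),
      measure_iUnion disjoint_cylinderSet_prod hE]
    have := hone.tsum_eq
    simp only [measureReal_def] at this
    rw [← ENNReal.tsum_toReal_eq (fun L => measure_ne_top μ _)] at this
    exact (ENNReal.toReal_eq_one_iff _).mp this
  have := hasSum_measureReal_preimage hE disjoint_cylinderSet_prod hcov
    (φ := fun ω : (ℕ → ℤ) × ℕ => walkRangeSize ω.1 ω.2 + 2)
    (g := fun L => histRange L + 2) (by
      rintro L ⟨ξ, k⟩ ⟨h1, h2⟩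
      simp only [Set.mem_singleton_iff] at h1 h2
      subst h2
      simp only [walkRangeSize_eq h1]) S
  simpa only [hmass] using this

/-! ### Convergence in distribution -/

theorem measurable_walk (i : ℕ) : Measurable fun ξ : ℕ → ℤ => walk ξ i :=
  Finset.measurable_sum _ fun j _ => measurable_pi_apply j

theorem measurable_walkRangeSize :
    Measurable fun ω : (ℕ → ℤ) × ℕ => walkRangeSize ω.1 ω.2 + 2 := by
  refine measurable_from_prod_countable_left fun k => ?_
  have h1 : Measurable fun (ξ : ℕ → ℤ) (i : Fin (k + 1)) => walk ξ i :=
    measurable_pi_lambda _ fun i => measurable_walk i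
  have h2 : Measurable fun v : Fin (k + 1) → ℤ => (Set.range v).ncard + 2 :=
    measurable_of_countable _
  convert h2.comp h1 using 1
  funext ξ
  simp only [Function.comp, walkRangeSize]
  congr 2
  ext z
  constructor
  · rintro ⟨i, hi, rfl⟩
    exact ⟨⟨i, by omega⟩, rfl⟩
  · rintro ⟨i, rfl⟩
    exact ⟨i, by omega, rfl⟩

/-- Convergence in distribution of integer-valued random variables from convergence of the
probabilities of all events. -/
theorem tendstoInDistribution_of_tendsto_measureReal {Ω : ℕ → Type*} {Ω' : Type*}
    [∀ k, MeasurableSpace (Ω k)] [MeasurableSpace Ω'] {X : (k : ℕ) → Ω k → ℕ} {Z : Ω' → ℕ}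
    {μ : (k : ℕ) → Measure (Ω k)} [∀ k, IsProbabilityMeasure (μ k)] {ν : Measure Ω'}
    [IsProbabilityMeasure ν] (hX : ∀ k, Measurable (X k)) (hZ : Measurable Z)
    (h : ∀ G : Set ℕ, Tendsto (fun k => (μ k).real (X k ⁻¹' G)) atTop (𝓝 (ν.real (Z ⁻¹' G)))) :
    TendstoInDistribution X atTop Z μ ν where
  forall_aemeasurable k := (hX k).aemeasurable
  aemeasurable_limit := hZ.aemeasurable
  tendsto := by
    refine tendsto_of_forall_isOpen_le_liminf' fun G _ => ?_
    simp only [ProbabilityMeasure.coe_mk]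
    rw [Measure.map_apply hZ MeasurableSet.of_discrete]
    have h1 : Tendsto (fun k => (μ k).map (X k) G) atTop (𝓝 (ν (Z ⁻¹' G))) := by
      have h2 : ∀ k, (μ k).map (X k) G = μ k (X k ⁻¹' G) := fun k =>
        Measure.map_apply (hX k) MeasurableSet.of_discrete
      simp only [h2]
      rw [← ENNReal.tendsto_toReal_iff (fun k => measure_ne_top _ _) (measure_ne_top _ _)]
      exact h G
    exact h1.liminf_eq.ge

/-- Convergence in distribution of the range size along sequences of constant parity. -/
theorem tendstoInDistribution_rangeSize {lam a C : ℝ} (hlam : 0 < lam) (ha : 0 < a)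
    {n d : ℕ → ℕ} (hn : Tendsto n atTop atTop)
    (hnd : Tendsto (fun k => (n k : ℝ) * ((2 : ℝ) ^ d k)⁻¹) atTop (𝓝 lam)) {r : ℕ}
    (hr : ∀ k, Even (n k) ↔ Even r) (hx : 0 < lam / (2 * √2)) (hC : 0 < C)
    (hth : ∀ j, theta (r + j) = C * if Even j then a else 1) :
    TendstoInDistribution (fun k (f : Fin (n k + 1) → ℤ) => rangeSize f) atTop
      (fun ω : (ℕ → ℤ) × ℕ => walkRangeSize ω.1 ω.2 + 2)
      (fun k => lineHomMeasure (n k) (d k))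
      (walkTimeMeasure (parityBiasedPoissonLaw (lam / (2 * √2)) a hx ha)) := by
  classical
  refine tendstoInDistribution_of_tendsto_measureReal (fun k => measurable_of_countable _)
    measurable_walkRangeSize fun G => ?_
  set x := lam / (2 * √2) with hxdef
  set D := a * Real.cosh x + Real.sinh x
  have hD : 0 < D := by
    have := Real.cosh_pos x
    have := Real.sinh_pos_iff.mpr hx
    positivity
  set ν := walkTimeMeasure (parityBiasedPoissonLaw x a hx ha)
  -- With λ = 2√2 x, the quotient λ^j / (4√2)^j is x^j 2^(-j): a Poisson factor times the
  -- probability of one sign sequence.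
  have hw : ∀ L : List Bool, 2 * (theta (r + L.length) * growth L.length * lam ^ L.length) =
      2 * C * D * ((parityBiasedPoisson x a).real {L.length} * (2⁻¹) ^ L.length) := by
    intro L
    rw [hth, parityBiasedPoisson_real_singleton hx ha]
    have : lam = x * (2 * √2) := by rw [hxdef]; field_simp
    rw [this, growth, mul_pow, mul_pow, mul_pow, show (4 : ℝ) = 2 * 2 by norm_num, mul_pow]
    change _ = 2 * C * D * (_ / D * _)
    rw [inv_pow]
    field_simp
  have hlim : ∀ (S : Set ℕ) [DecidablePred (· ∈ S)], (∑' L : List Bool, if histRange L + 2 ∈ S then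
        2 * (theta (r + L.length) * growth L.length * lam ^ L.length) else 0) =
      2 * C * D * ν.real ((fun ω : (ℕ → ℤ) × ℕ => walkRangeSize ω.1 ω.2 + 2) ⁻¹' S) := by
    intro S _
    have := (hasSum_walkTimeMeasure hx ha S).mul_left (2 * C * D)
    rw [← this.tsum_eq]
    congr 1
    funext L
    split_ifs
    · exact hw L
    · simp
  have h1 := tendsto_ncard_lineHom hlam hn hnd hr G
  -- The total mass gives the normalising constant 2CD, which cancels in the quotient.
  have h2 := tendsto_ncard_lineHom hlam hn hnd hr Set.univ
  rw [hlim] at h1 h2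
  rw [Set.preimage_univ, probReal_univ, mul_one] at h2
  have h3 := h1.div h2 (by positivity)
  rw [mul_div_cancel_left₀ _ (by positivity : 2 * C * D ≠ 0)] at h3
  refine h3.congr fun k => ?_
  rw [lineHomMeasure_real]
  exact div_div_div_cancel_right₀ (by positivity) _ _

end ZHom

theorem theorem2p5 (lam : ℝ) (hlam : 0 < lam) (n d : ℕ → ℕ)
    (hn : Tendsto n atTop atTop)
    (hnd : Tendsto (fun k => (n k : ℝ) * ((2 : ℝ) ^ d k)⁻¹) atTop (𝓝 lam)) :
    ((∀ k, Even (n k)) →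
      TendstoInDistribution
        (fun k (f : Fin (n k + 1) → ℤ) => ZHom.rangeSize f) atTop
        (fun ω : (ℕ → ℤ) × ℕ => ZHom.walkRangeSize ω.1 ω.2 + 2)
        (fun k => ZHom.lineHomMeasure (n k) (d k))
        (ZHom.walkTimeMeasure
          (ZHom.parityBiasedPoissonLaw (lam / (2 * √2)) (3 / (2 * √2))
            (by positivity) (by positivity)))) ∧
    ((∀ k, Odd (n k)) →
      TendstoInDistribution
        (fun k (f : Fin (n k + 1) → ℤ) => ZHom.rangeSize f) atTop
        (fun ω : (ℕ → ℤ) × ℕ => ZHom.walkRangeSize ω.1 ω.2 + 2)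
        (fun k => ZHom.lineHomMeasure (n k) (d k))
        (ZHom.walkTimeMeasure
          (ZHom.parityBiasedPoissonLaw (lam / (2 * √2)) (3 / (2 * √2))⁻¹
            (by positivity) (by positivity)))) := by
  have h2 : √2 * √2 = 2 := Real.mul_self_sqrt (by norm_num)
  refine ⟨fun he => ?_, fun ho => ?_⟩
  -- `C` is θ at odd arguments, and the bias is (3/2)/√2.
  · refine ZHom.tendstoInDistribution_rangeSize (C := √2) (r := 0) hlam (by positivity) hn hnd
      (fun k => by simp [he k]) (by positivity) (by positivity) fun j => ?_
    rw [ZHom.theta, zero_add]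
    split_ifs
    · field_simp
    · ring
  -- For odd n the two values of θ exchange roles, which inverts the bias.
  · refine ZHom.tendstoInDistribution_rangeSize (C := 3 / 2) (r := 1) hlam (by positivity) hn hnd
      (fun k => by simpa using ho k) (by positivity) (by positivity) fun j => ?_
    have : Even (1 + j) ↔ ¬ Even j := by simp only [Nat.even_iff]; omega
    simp only [ZHom.theta, this]
    by_cases hj : Even j
    · simp only [hj, not_true_eq_false, if_false, if_true]
      field_simp
    · simp [hj]
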